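/- Let $\mathcal M$ be a complex manifold of dimension $n$ and let $1\le q\le n$. For $1\le k\le n$ and $0<r<1$ put $\mathbb S_r^k=\{z\in\mathbb C^k:\|z\|=1,\ \operatorname{Re}z_1\ge r\}$, $\widehat{\mathbb S}_r^k=\{z\in\mathbb C^k:\|z\|\le 1,\ \operatorname{Re}z_1\ge r\}$ (Euclidean norm), and let $\Delta^{m}=\{z\in\mathbb C^{m}:|z_j|<1 \text{ for all } j\}$. A spherical hat pair of order $k$ in $\mathcal M$ is a pair $(S,\widehat S)$ with $S=\Phi(\mathbb S_r^k\times\Delta^{n-k})$ and $\widehat S=\Phi(\widehat{\mathbb S}_r^k\times\Delta^{n-k})$ for some $0<r<1$ and some injective holomorphic map $\Phi$ into $\mathcal M$ from an open neighborhood of $\widehat{\mathbb S}_r^k\times\overline{\Delta^{n-k}}$ in $\mathbb C^n$; its filling is $\operatorname{Int}(\widehat S)=\Phi\big(\operatorname{int}(\widehat{\mathbb S}_r^k\times\Delta^{n-k})\big)$. A real-valued $\mathcal C^2$ function on an open subset of $\mathcal M$ is called weakly $q$-convex (respectively $q$-convex) if at every point its Levi form has at most $q-1$ negative (respectively non-positive)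 eigenvalues, counted with multiplicity. Let $(S,\widehat S)$ be a spherical hat pair of order $n-q+1$ in $\mathcal M$. Then there are an open neighborhood $U$ of the filled hat $\widehat S$, with $U\setminus S$ open, and a weakly $q$-convex function $\varphi$ on $U\setminus S$ such that $\varphi=0$ on $U\setminus\widehat S$, and $\varphi$ is positive and $q$-convex on the filling $\operatorname{Int}(\widehat S)$, which is an open set. -/

import Mathlib

open scoped Manifold ContDiff

noncomputable section

/-- The coordinate space `ℂⁿ` with its Euclidean norm. -/
abbrev Cn (n : ℕ) : Type := EuclideanSpace ℂ (Fin n)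

/-- The spherical hat in `ℂᵏ`: unit vectors whose first coordinate has real part at least `r`. -/
def sphericalHat (k : ℕ) [NeZero k] (r : ℝ) : Set (Cn k) :=
  {z | ‖z‖ = 1 ∧ r ≤ (z 0).re}

/-- The filled spherical hat in `ℂᵏ`. -/
def filledSphericalHat (k : ℕ) [NeZero k] (r : ℝ) : Set (Cn k) :=
  {z | ‖z‖ ≤ 1 ∧ r ≤ (z 0).re}

/-- The open unit polydisc in `ℂᵐ`. -/
def unitPolydisc (m : ℕ) : Set (Cn m) :=
  {z | ∀ i, ‖z i‖ < 1}

/-- The first `k` coordinates of a point of `ℂⁿ`. -/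
def headCoords {k n : ℕ} (hk : k ≤ n) (z : Cn n) : Cn k :=
  WithLp.toLp 2 fun i => z (Fin.castLE hk i)

/-- The last `n - k` coordinates of a point of `ℂⁿ`. -/
def tailCoords {k n : ℕ} (hk : k ≤ n) (z : Cn n) : Cn (n - k) :=
  WithLp.toLp 2 fun i => z (Fin.cast (Nat.add_sub_of_le hk) (Fin.natAdd k i))

/-- The product `A × B` of `A ⊆ ℂᵏ` and `B ⊆ ℂⁿ⁻ᵏ`, as a subset of `ℂⁿ`. -/
def coordProd {k n : ℕ} (hk : k ≤ n) (A : Set (Cn k)) (B : Set (Cn (n - k))) : Set (Cn n) :=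
  {z | headCoords hk z ∈ A ∧ tailCoords hk z ∈ B}

/-- A spherical hat pair of order `k` in the complex manifold `M` of dimension `n`: a radius
`0 < r < 1` and an injective holomorphic map `toFun` from an open neighbourhood `dom` of
(filled hat) × (closed polydisc) into `M`. The pair of sets itself is `(P.hat, P.filledHat)`.
(`toFun` is a total function; only its values on `dom` matter.) -/
structure SphericalHatPair (k n : ℕ) [NeZero k] (M : Type*) [TopologicalSpace M]
    [ChartedSpace (Cn n) M] where
  order_le : k ≤ n
  r : ℝ
  r_pos : 0 < r
  r_lt_one : r < 1
  dom : Set (Cn n)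
  isOpen_dom : IsOpen dom
  subset_dom : coordProd order_le (filledSphericalHat k r) (closure (unitPolydisc (n - k))) ⊆ dom
  toFun : Cn n → M
  holomorphic : ContMDiffOn 𝓘(ℂ, Cn n) 𝓘(ℂ, Cn n) ω toFun dom
  injOn : Set.InjOn toFun dom

namespace SphericalHatPair

variable {k n : ℕ} [NeZero k] {M : Type*} [TopologicalSpace M] [ChartedSpace (Cn n) M]

/-- The hat `S`, the image of (spherical hat) × (open polydisc). -/
def hat (P : SphericalHatPair k n M) : Set M :=
  P.toFun '' coordProd P.order_le (sphericalHat k P.r) (unitPolydisc (n - k))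

/-- The filled hat `Ŝ`, the image of (filled spherical hat) × (open polydisc). -/
def filledHat (P : SphericalHatPair k n M) : Set M :=
  P.toFun '' coordProd P.order_le (filledSphericalHat k P.r) (unitPolydisc (n - k))

/-- The filling of `S`, the image of the interior of (filled spherical hat) × (open polydisc). -/
def filling (P : SphericalHatPair k n M) : Set M :=
  P.toFun '' interior (coordProd P.order_le (filledSphericalHat k P.r) (unitPolydisc (n - k)))

end SphericalHatPair

/-- The second real derivative of `u : ℂⁿ → ℝ` at `z`, in the directions `v` and `w`. -/
def realHessian {n : ℕ} (u : Cn n → ℝ) (z v w : Cn n) : ℝ :=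
  fderiv ℝ (fderiv ℝ u) z v w

/-- The matrix `(∂²u / ∂z_j ∂z̄_k)` of the Levi form of `u` at `z`. With `z_j = x_j + i y_j`, its
`(j, k)` entry is
`(1/4) (u_{x_j x_k} + u_{y_j y_k} + i (u_{x_j y_k} - u_{y_j x_k}))`. -/
def leviMatrix {n : ℕ} (u : Cn n → ℝ) (z : Cn n) : Matrix (Fin n) (Fin n) ℂ :=
  Matrix.of fun j k =>
    let ex : Fin n → Cn n := fun i => EuclideanSpace.single i 1
    let ey : Fin n → Cn n := fun i => EuclideanSpace.single i Complex.I
    (1 / 4 : ℂ) *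
      (((realHessian u z (ex j) (ex k) + realHessian u z (ey j) (ey k) : ℝ) : ℂ) +
        Complex.I * ((realHessian u z (ex j) (ey k) - realHessian u z (ey j) (ex k) : ℝ) : ℂ))

section QConvex

variable {n : ℕ} {M : Type*} [TopologicalSpace M] [ChartedSpace (Cn n) M]

/-- `ψ` is weakly `q`-convex on the open set `V`: it is (real) `C²` on `V`, and at every point of
`V`, in every holomorphic chart, its Levi form has at most `q - 1` negative eigenvalues, counted
with multiplicity. -/
structure IsWeaklyQConvexOn (q : ℕ) (ψ : M → ℝ) (V : Set M) : Prop where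
  isOpen : IsOpen V
  contMDiffOn : ContMDiffOn 𝓘(ℝ, Cn n) 𝓘(ℝ, ℝ) 2 ψ V
  levi : ∀ e ∈ IsManifold.maximalAtlas 𝓘(ℂ, Cn n) ω M, ∀ p ∈ V, p ∈ e.source →
    ∃ h : (leviMatrix (ψ ∘ e.symm) (e p)).IsHermitian, {i | h.eigenvalues i < 0}.ncard < q

/-- `ψ` is `q`-convex on the open set `V`: it is (real) `C²` on `V`, and at every point of `V`, in
every holomorphic chart, its Levi form has at most `q - 1` non-positive eigenvalues, counted with
multiplicity. -/
structure IsQConvexOn (q : ℕ) (ψ : M → ℝ) (V : Set M) : Prop where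
  isOpen : IsOpen V
  contMDiffOn : ContMDiffOn 𝓘(ℝ, Cn n) 𝓘(ℝ, ℝ) 2 ψ V
  levi : ∀ e ∈ IsManifold.maximalAtlas 𝓘(ℂ, Cn n) ω M, ∀ p ∈ V, p ∈ e.source →
    ∃ h : (leviMatrix (ψ ∘ e.symm) (e p)).IsHermitian, {i | h.eigenvalues i ≤ 0}.ncard < q

end QConvex

end

/-! Put `k = n - q + 1` and let `z'` be the first `k` coordinates. In the coordinates given by `Φ`,
take `(Re z₁ - r)₊⁴ (2 + ‖z'‖²)` for `‖z'‖ < 1` and `0` elsewhere. A unit vector `z'` off the hat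
has `Re z₁ < r`, where the first formula already vanishes; hence the cut-off is `C²` away from the
hat. Its Levi form is nonnegative, and on the filling it vanishes only on vectors with `v' = 0`, a
space of dimension `n - k = q - 1`. This gives both convexity claims (`leviForm_hatModel_ge`,
`ncard_leviMatrix_nonpos_lt`).

Carrying this to `M` requires `Φ⁻¹` to be holomorphic. That is Osgood's theorem,
`fderiv_injective_of_injOn`, proved by induction on the dimension. A nonzero singular derivative is
excluded by restricting to a level set of a linear functional. A zero derivative is excluded because
the Jacobian determinant would then vanish along a holomorphic curve on which the map is constant.
Since the Levi form is natural under holomorphic maps, the eigenvalue bounds then hold in every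
chart. -/

open Filter Topology Metric Set

/-! ### Osgood's theorem on injective holomorphic maps. -/

/-- An injective holomorphic function of one variable has nonvanishing derivative. -/
theorem deriv_ne_zero_of_injOn {f : ℂ → ℂ} {Ω : Set ℂ} (hΩ : IsOpen Ω)
    (hf : AnalyticOnNhd ℂ f Ω) (hinj : InjOn f Ω) {a : ℂ} (ha : a ∈ Ω) : deriv f a ≠ 0 := by
  intro h0
  have nonconst : ∀ z ∈ Ω, ∀ c, ¬ ∀ᶠ w in 𝓝 z, f w = c := by
    intro z hz c h
    obtain ⟨w, ⟨hw, hwΩ⟩, hne⟩ :=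
      (((h.and (hΩ.mem_nhds hz)).filter_mono nhdsWithin_le_nhds).and
        (self_mem_nhdsWithin (s := {z}ᶜ) (a := z))).exists
    exact hne (hinj hwΩ hz (hw.trans h.self_of_nhds.symm))
  have hopen : ∀ z ∈ Ω, 𝓝 (f z) ≤ map f (𝓝 z) := fun z hz ↦
    (hf z hz).eventually_constant_or_nhds_le_map_nhds.resolve_left (nonconst z hz _)
  set g := Function.invFunOn f Ω with hg
  have hgf : ∀ z ∈ Ω, g (f z) = z := fun z hz ↦ hinj.leftInvOn_invFunOn hz
  have hgev : ∀ z ∈ Ω, ∀ᶠ w in 𝓝 (f z), g w ∈ Ω ∧ f (g w) = w := by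
    intro z hz
    refine hopen z hz ?_
    rw [mem_map]
    filter_upwards [hΩ.mem_nhds hz] with w hw
    simp [hgf w hw, hw]
  have hgcont : ∀ z ∈ Ω, ContinuousAt g (f z) := by
    intro z hz
    have : Tendsto (g ∘ f) (𝓝 z) (𝓝 z) :=
      tendsto_id.congr' ((hΩ.eventually_mem hz).mono fun w hw ↦ (hgf w hw).symm)
    rw [ContinuousAt, hgf z hz]
    exact (tendsto_map'_iff.2 this).mono_left (hopen z hz)
  have hgdiff : ∀ z ∈ Ω, deriv f z ≠ 0 → DifferentiableAt ℂ g (f z) := by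
    intro z hz hd
    refine (HasDerivAt.of_local_left_inverse (f := f) (f' := deriv f z) (hgcont z hz) ?_ hd
      ((hgev z hz).mono fun w hw ↦ hw.2)).differentiableAt
    rw [hgf z hz]
    exact (hf z hz).differentiableAt.hasDerivAt
  -- Otherwise `f'` vanishes on a ball around `a`, and `f` is constant there.
  have hpunct : ∀ᶠ z in 𝓝[≠] a, deriv f z ≠ 0 := by
    refine (hf a ha).deriv.eventually_eq_zero_or_eventually_ne_zero.resolve_left fun h ↦ ?_
    obtain ⟨ρ, hρ, hb⟩ := Metric.eventually_nhds_iff_ball.1 (h.and (hΩ.eventually_mem ha))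
    refine nonconst a ha (f a) (mem_of_superset (ball_mem_nhds a hρ) fun w hw ↦ ?_)
    refine isOpen_ball.is_const_of_deriv_eq_zero (convex_ball a ρ).isPreconnected
      (fun z hz ↦ ((hf z (hb z hz).2).differentiableAt).differentiableWithinAt)
      (fun z hz ↦ (hb z hz).1) hw (mem_ball_self hρ)
  -- Removable singularity: the inverse `g` is continuous at `f a` and differentiable at the other
  -- nearby points. Differentiating `g ∘ f = id` at `a` then contradicts `f'(a) = 0`.
  have hgan : AnalyticAt ℂ g (f a) := by
    refine Complex.analyticAt_of_differentiable_on_punctured_nhds_of_continuousAt ?_ (hgcont a ha)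
    rw [eventually_nhdsWithin_iff] at hpunct ⊢
    refine (hopen a ha) ?_
    rw [mem_map]
    filter_upwards [hpunct, hΩ.mem_nhds ha] with w hw hwΩ hne
    exact hgdiff w hwΩ (hw fun h ↦ hne (by rw [mem_singleton_iff.1 h]; rfl))
  have h1 : HasDerivAt (g ∘ f) (deriv g (f a) * deriv f a) a :=
    hgan.differentiableAt.hasDerivAt.comp a (hf a ha).differentiableAt.hasDerivAt
  have h2 : HasDerivAt (g ∘ f) 1 a :=
    (hasDerivAt_id a).congr_of_eventuallyEq ((hΩ.eventually_mem ha).mono fun w hw ↦ hgf w hw)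
  simpa [h0] using h1.unique h2

/-- Persistence of zeros: a zero of `j (s₀, ·)` which is isolated on a circle survives for
nearby values of the parameter. -/
theorem eventually_exists_zero {j : ℂ × ℂ → ℂ} {s₀ w₀ : ℂ} {ε : ℝ} (hε : 0 < ε)
    (hj : ∀ᶠ s in 𝓝 s₀, ∀ w ∈ closedBall w₀ ε, AnalyticAt ℂ j (s, w)) (h0 : j (s₀, w₀) = 0)
    (hne : ∀ w ∈ sphere w₀ ε, j (s₀, w) ≠ 0) :
    ∀ᶠ s in 𝓝 s₀, ∃ w ∈ ball w₀ ε, j (s, w) = 0 := by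
  have hj0 := hj.self_of_nhds
  obtain ⟨c, hc, hcle⟩ : ∃ c > 0, ∀ w ∈ sphere w₀ ε, c < ‖j (s₀, w)‖ := by
    have hcont : ContinuousOn (fun w ↦ ‖j (s₀, w)‖) (sphere w₀ ε) := fun w hw ↦
      (((hj0 w (sphere_subset_closedBall hw)).continuousAt.comp
        (f := fun w ↦ (s₀, w)) (by fun_prop)).norm).continuousWithinAt
    obtain ⟨w, hw, hmin⟩ := (isCompact_sphere w₀ ε).exists_isMinOn
      (NormedSpace.sphere_nonempty.2 hε.le) hcont
    refine ⟨‖j (s₀, w)‖ / 2, by have := norm_pos_iff.2 (hne w hw); positivity, fun v hv ↦ ?_⟩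
    have := norm_pos_iff.2 (hne w hw)
    have h2 : ‖j (s₀, w)‖ ≤ ‖j (s₀, v)‖ := hmin hv
    linarith
  have hsph : ∀ᶠ s in 𝓝 s₀, ∀ w ∈ sphere w₀ ε, c < ‖j (s, w)‖ := by
    refine (isCompact_sphere w₀ ε).eventually_forall_of_forall_eventually fun w hw ↦ ?_
    exact (hj0 w (sphere_subset_closedBall hw)).continuousAt.norm.eventually_const_lt (hcle w hw)
  have hcen : ∀ᶠ s in 𝓝 s₀, ‖j (s, w₀)‖ < c := by
    have : ContinuousAt (fun s ↦ ‖j (s, w₀)‖) s₀ :=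
      ((hj0 w₀ (mem_closedBall_self hε.le)).continuousAt.comp
        (f := fun s ↦ (s, w₀)) (by fun_prop)).norm
    refine this.eventually_lt_const ?_
    simpa [h0] using hc
  filter_upwards [hj, hsph, hcen] with s hs hs1 hs2
  -- Without zeros, `1 / j (s, ·)` is holomorphic on the disc and bounded by `1 / c` on the circle.
  -- The maximum principle contradicts `‖j (s, w₀)‖ < c`.
  by_contra! hnz
  have hnz' : ∀ w ∈ closedBall w₀ ε, j (s, w) ≠ 0 := fun w hw ↦ by
    rcases (mem_closedBall.1 hw).lt_or_eq with h | h
    · exact hnz w h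
    · exact norm_pos_iff.1 (hc.trans (hs1 w h))
  have hd : DiffContOnCl ℂ (fun w ↦ (j (s, w))⁻¹) (ball w₀ ε) := by
    refine DifferentiableOn.diffContOnCl fun w hw ↦ ?_
    rw [closure_ball w₀ hε.ne'] at hw
    exact (((hs w hw).differentiableAt.comp w (f := fun w ↦ (s, w)) (by fun_prop)).inv
      (hnz' w hw)).differentiableWithinAt
  have := Complex.norm_le_of_forall_mem_frontier_norm_le (C := c⁻¹) isBounded_ball hd
    (fun w hw ↦ by
      rw [frontier_ball w₀ hε.ne'] at hw
      rw [norm_inv]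
      exact inv_anti₀ hc (hs1 w hw).le) (subset_closure (mem_ball_self hε))
  rw [norm_inv] at this
  exact absurd ((inv_le_inv₀ (norm_pos_iff.2 (hnz' _ (mem_closedBall_self hε.le))) hc).1 this)
    (not_le.2 hs2)

/-- The zero set of a holomorphic function of two variables, not vanishing identically on the
vertical axis, contains a graph arbitrarily close to any of its points. -/
theorem exists_zero_graph {j : ℂ × ℂ → ℂ} {N : Set (ℂ × ℂ)} (hN : N ∈ 𝓝 (0 : ℂ × ℂ))
    (hj : AnalyticAt ℂ j 0) (h0 : j 0 = 0) (hne : ¬ ∀ᶠ w in 𝓝 (0 : ℂ), j (0, w) = 0) :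
    ∃ (s₀ : ℂ) (h : ℂ → ℂ), ∀ᶠ s in 𝓝 s₀,
      DifferentiableAt ℂ h s ∧ j (s, h s) = 0 ∧ (s, h s) ∈ N := by
  obtain ⟨ρ, hρ, hb⟩ := Metric.eventually_nhds_iff_ball.1 (hj.eventually_analyticAt.and hN)
  set B : Set (ℂ × ℂ) := ball 0 ρ
  have hBo : IsOpen B := isOpen_ball
  -- `D m` is the `m`-th derivative of `j` in the second variable.
  let D : ℕ → ℂ × ℂ → ℂ := fun m ↦ Nat.rec j (fun _ g p ↦ fderiv ℂ g p (0, 1)) m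
  have hD : ∀ m, AnalyticOnNhd ℂ (D m) B := by
    intro m
    induction m with
    | zero => exact fun p hp ↦ (hb p hp).1
    | succ m ih =>
      intro p hp
      exact ((ContinuousLinearMap.apply ℂ ℂ ((0, 1) : ℂ × ℂ)).analyticAt _).comp (ih p hp).fderiv
  have hDd : ∀ m s w, (s, w) ∈ B → HasDerivAt (fun w ↦ D m (s, w)) (D (m + 1) (s, w)) w := by
    intro m s w hp
    have h1 : HasDerivAt (fun w : ℂ ↦ (s, w)) (0, 1) w :=
      (hasDerivAt_const w s).prodMk (hasDerivAt_id w)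
    exact (hD m (s, w) hp).differentiableAt.hasFDerivAt.comp_hasDerivAt w h1
  have hslice : ∀ s w, (s, w) ∈ B → ∀ᶠ v in 𝓝 w, (s, v) ∈ B := fun s w hp ↦
    (show ContinuousAt (fun v : ℂ ↦ (s, v)) w by fun_prop).eventually_mem (hBo.mem_nhds hp)
  have hDiter : ∀ m s w, (s, w) ∈ B → iteratedDeriv m (fun w ↦ j (s, w)) w = D m (s, w) := by
    intro m
    induction m with
    | zero => intro s w _; rfl
    | succ m ih =>
      intro s w hp
      have he : iteratedDeriv m (fun w ↦ j (s, w)) =ᶠ[𝓝 w] fun v ↦ D m (s, v) :=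
        (hslice s w hp).mono fun v hv ↦ ih s v hv
      rw [iteratedDeriv_succ, he.deriv_eq]
      exact (hDd m s w hp).deriv
  have hjs : ∀ s w, (s, w) ∈ B → AnalyticAt ℂ (fun w ↦ j (s, w)) w := fun s w hp ↦
    (hD 0 (s, w) hp).fun_comp (f := fun w : ℂ ↦ (s, w)) (by fun_prop)
  have hzero : ∀ s w, (s, w) ∈ B → ((∀ᶠ v in 𝓝 w, j (s, v) = 0) ↔ ∀ m, D m (s, w) = 0) := by
    intro s w hp
    rw [← analyticOrderAt_eq_top, ENat.eq_top_iff_forall_ge]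
    simp_rw [natCast_le_analyticOrderAt_iff_iteratedDeriv_eq_zero (hjs s w hp), hDiter _ s w hp]
    exact ⟨fun h m ↦ h (m + 1) m (Nat.lt_succ_self m), fun h m i _ ↦ h i⟩
  have hex : ∃ m, ∃ p ∈ B, j p = 0 ∧ D m p ≠ 0 := by
    have h0B : ((0 : ℂ), (0 : ℂ)) ∈ B := mem_ball_self hρ
    rw [hzero 0 0 h0B, not_forall] at hne
    obtain ⟨m, hm⟩ := hne
    exact ⟨m, _, h0B, h0, hm⟩
  -- Take `m` minimal among the orders of nonvanishing at zeros of `j` in `B`. With `m = k + 1`,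
  -- every zero of `j` in `B` is a zero of `D k`, whose vertical derivative is nonzero at `(s₀,
  -- w₀)`. The implicit function theorem makes `{D k = 0}` a graph near that point. Zeros of `j`
  -- persist for nearby `s` and must lie on this graph, so `j` vanishes along it.
  obtain ⟨m, ⟨⟨s₀, w₀⟩, hpB, hp0, hpm⟩, hmin'⟩ : ∃ m, (∃ p ∈ B, j p = 0 ∧ D m p ≠ 0) ∧
      ∀ i < m, ¬ ∃ p ∈ B, j p = 0 ∧ D i p ≠ 0 := by
    classical exact ⟨Nat.find hex, Nat.find_spec hex, fun i hi ↦ Nat.find_min hex hi⟩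
  have hmin : ∀ i < m, ∀ p ∈ B, j p = 0 → D i p = 0 := fun i hi p hp hjp ↦
    not_not.1 fun hcon ↦ hmin' i hi ⟨p, hp, hjp, hcon⟩
  obtain ⟨k, hk⟩ : ∃ k, m = k + 1 := Nat.exists_eq_succ_of_ne_zero fun h ↦ by
    rw [h] at hpm; exact hpm hp0
  rw [hk] at hpm hmin
  have hg0 : ∀ p ∈ B, j p = 0 → D k p = 0 := hmin k (Nat.lt_succ_self k)
  have hcd : ContDiffAt ℂ ω (D k) (s₀, w₀) := (hD k _ hpB).contDiffAt
  have hinv : (fderiv ℂ (D k) (s₀, w₀) ∘L .inr ℂ ℂ ℂ).IsInvertible := by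
    refine ⟨ContinuousLinearEquiv.smulLeft (Units.mk0 _ hpm), ?_⟩
    ext
    simp [D]
  have hgraph := hcd.eventually_apply_eq_iff_implicitFunction (by simp) hinv
  have hsm := hcd.contDiffAt_implicitFunction (by simp) hinv
  set h := hcd.implicitFunction (by simp) hinv
  obtain ⟨δ, hδ, hδb⟩ := Metric.eventually_nhds_iff_ball.1 (hgraph.and (hBo.eventually_mem hpB))
  have hiso : ∀ᶠ w in 𝓝[≠] w₀, j (s₀, w) ≠ 0 :=
    (hjs s₀ w₀ hpB).eventually_eq_zero_or_eventually_ne_zero.resolve_left fun hz ↦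
      hpm ((hzero s₀ w₀ hpB).1 hz (k + 1))
  rw [eventually_nhdsWithin_iff, Metric.eventually_nhds_iff_ball] at hiso
  obtain ⟨η, hη, hηb⟩ := hiso
  set ε := min δ η / 2
  have hε : 0 < ε := by positivity
  have hεδ : ε < δ := by have := min_le_left δ η; have := lt_min hδ hη; simp only [ε]; linarith
  have hεη : ε < η := by have := min_le_right δ η; have := lt_min hδ hη; simp only [ε]; linarith
  have hbox : ∀ s ∈ ball s₀ δ, ∀ w ∈ closedBall w₀ ε, (s, w) ∈ ball (s₀, w₀) δ := by
    intro s hs w hw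
    rw [← ball_prod_same]
    exact ⟨hs, (mem_closedBall.1 hw).trans_lt hεδ⟩
  have hzer := eventually_exists_zero (j := j) (s₀ := s₀) (w₀ := w₀) hε
    (by
      filter_upwards [ball_mem_nhds s₀ hδ] with s hs w hw
      exact hD 0 _ (hδb _ (hbox s hs w hw)).2) hp0
    (fun w hw ↦ hηb w (mem_ball.2 ((mem_sphere.1 hw).trans_lt hεη)) fun hww ↦ by
      rw [mem_singleton_iff.1 hww, mem_sphere, dist_self] at hw
      exact hε.ne hw)
  refine ⟨s₀, h, ?_⟩
  filter_upwards [hzer, ball_mem_nhds s₀ hδ, (hsm.of_le le_top : ContDiffAt ℂ 1 h s₀).eventually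
    (by simp)] with s ⟨w, hw, hjw⟩ hs hds
  have hmem := hδb _ (hbox s hs w (ball_subset_closedBall hw))
  have hh : h s = w := hmem.1.1 ((hg0 _ hmem.2 hjw).trans (hg0 _ hpB hp0).symm)
  rw [hh]
  exact ⟨hds.differentiableAt (by simp), hjw, (hb _ hmem.2).2⟩

theorem ContinuousLinearMap.contDiff_det {E : Type*} [NormedAddCommGroup E] [NormedSpace ℂ E]
    [FiniteDimensional ℂ E] : ContDiff ℂ ω (fun A : E →L[ℂ] E ↦ A.det) := by
  let b := Module.finBasis ℂ E
  have hdet : (fun A : E →L[ℂ] E ↦ A.det) = fun A : E →L[ℂ] E ↦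
      ∑ σ : Equiv.Perm (Fin (Module.finrank ℂ E)), (Equiv.Perm.sign σ : ℂ) *
        ∏ i, b.coord (σ i) (A (b i)) := by
    ext A
    rw [ContinuousLinearMap.det, ← LinearMap.det_toMatrix b, Matrix.det_apply']
    simp [LinearMap.toMatrix_apply]
  rw [hdet]
  refine ContDiff.sum fun σ _ ↦ contDiff_const.mul (contDiff_prod fun i _ ↦ ?_)
  exact ((b.coord (σ i)).toContinuousLinearMap ∘L
    ContinuousLinearMap.apply ℂ E (b i)).contDiff

universe u v

/-- A holomorphic function which does not vanish identically near `a` is, on some complex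
line through `a`, not locally zero near `a`. -/
theorem exists_line_not_eventually_zero {E : Type*} [NormedAddCommGroup E] [NormedSpace ℂ E]
    {J : E → ℂ} {a : E} (hJ : AnalyticAt ℂ J a) (hne : ¬ ∀ᶠ z in 𝓝 a, J z = 0) :
    ∃ v : E, ¬ ∀ᶠ w in 𝓝 (0 : ℂ), J (a + w • v) = 0 := by
  obtain ⟨ρ, hρ, hb⟩ := Metric.eventually_nhds_iff_ball.1 hJ.eventually_analyticAt
  obtain ⟨b, hbρ, hJb⟩ : ∃ b ∈ ball a ρ, J b ≠ 0 := by
    by_contra! h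
    exact hne (mem_of_superset (ball_mem_nhds a hρ) h)
  refine ⟨b - a, fun hev ↦ hJb ?_⟩
  let c : ℂ → E := fun w ↦ a + w • (b - a)
  have hc : AnalyticOnNhd ℂ (fun w ↦ J (c w)) (c ⁻¹' ball a ρ) := fun w hw ↦
    (hb _ hw).fun_comp (f := c) (by fun_prop)
  have hconv : Convex ℝ (c ⁻¹' ball a ρ) := by
    intro x hx y hy s t hs ht hst
    have : c (s • x + t • y) = s • c x + t • c y := by
      simp only [c, add_smul, smul_add, smul_assoc]
      rw [show s • a + s • x • (b - a) + (t • a + t • y • (b - a)) =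
        (s • a + t • a) + (s • x • (b - a) + t • y • (b - a)) by abel, ← add_smul, hst, one_smul]
    rw [mem_preimage, this]
    exact convex_ball a ρ hx hy hs ht hst
  have := hc.eqOn_zero_of_preconnected_of_eventuallyEq_zero hconv.isPreconnected
    (z₀ := 0) (by simpa [c] using hρ) hev (show (1 : ℂ) ∈ _ by simpa [c] using hbρ)
  simpa [c] using this

theorem not_eventually_const_of_injOn {E F : Type*} [NormedAddCommGroup E] [NormedSpace ℂ E]
    [Nontrivial E] {f : E → F} {Ω : Set E} (hΩ : IsOpen Ω) (hinj : InjOn f Ω) {a : E} (ha : a ∈ Ω)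
    (c : F) : ¬ ∀ᶠ z in 𝓝 a, f z = c := by
  intro h
  have : (𝓝[≠] a).NeBot := Module.punctured_nhds_neBot ℂ E a
  obtain ⟨w, ⟨hw, hwΩ⟩, hne⟩ :=
    (((h.and (hΩ.mem_nhds ha)).filter_mono nhdsWithin_le_nhds).and
      (self_mem_nhdsWithin (s := {a}ᶜ) (a := a))).exists
  exact hne (hinj hwΩ ha (hw.trans h.self_of_nhds.symm))

/-- **Osgood's theorem**, in the case where the derivative vanishes wherever it is singular. -/
theorem fderiv_ne_zero_of_injOn {E : Type u} {F : Type v} [NormedAddCommGroup E] [NormedSpace ℂ E]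
    [FiniteDimensional ℂ E] [NormedAddCommGroup F] [NormedSpace ℂ F] [FiniteDimensional ℂ F]
    (hEF : Module.finrank ℂ E = Module.finrank ℂ F) (hE : 2 ≤ Module.finrank ℂ E)
    {f : E → F} {Ω : Set E} (hΩ : IsOpen Ω) (hf : AnalyticOnNhd ℂ f Ω) (hinj : InjOn f Ω)
    (hsing : ∀ z ∈ Ω, ¬ Function.Injective (fderiv ℂ f z) → fderiv ℂ f z = 0)
    {a : E} (ha : a ∈ Ω) : fderiv ℂ f a ≠ 0 := by
  intro hfa
  have : Nontrivial E := Module.nontrivial_of_finrank_pos (R := ℂ) (by omega)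
  let e : F ≃L[ℂ] E := ContinuousLinearEquiv.ofFinrankEq hEF.symm
  let J : E → ℂ := fun z ↦ ((e : F →L[ℂ] E) ∘L fderiv ℂ f z).det
  have hJ : ∀ z ∈ Ω, AnalyticAt ℂ J z := by
    intro z hz
    have h1 : AnalyticAt ℂ (fun z ↦ (e : F →L[ℂ] E) ∘L fderiv ℂ f z) z :=
      (ContinuousLinearMap.analyticAt (ContinuousLinearMap.compL ℂ E F E (e : F →L[ℂ] E)) _).comp
        (hf z hz).fderiv
    exact (ContinuousLinearMap.contDiff_det (E := E)).contDiffAt.analyticAt.fun_comp h1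
  have hJz : ∀ z ∈ Ω, J z = 0 → fderiv ℂ f z = 0 := by
    intro z hz h0
    refine hsing z hz fun hi ↦ ?_
    have hinj' : Function.Injective ((e : F →L[ℂ] E) ∘L fderiv ℂ f z).toLinearMap :=
      e.injective.comp hi
    exact (LinearMap.isUnit_det _ ((LinearMap.isUnit_iff_ker_eq_bot _).2
      (LinearMap.ker_eq_bot.2 hinj'))).ne_zero h0
  have hJa : J a = 0 := by
    simp only [J, hfa, ContinuousLinearMap.comp_zero, ContinuousLinearMap.det]
    rw [ContinuousLinearMap.toLinearMap_zero, LinearMap.det_zero, zero_pow (by omega)]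
  -- If `J` vanished near `a`, so would `f'`, and `f` would be locally constant.
  have hJne : ¬ ∀ᶠ z in 𝓝 a, J z = 0 := by
    intro h
    obtain ⟨ρ, hρ, hb⟩ := Metric.eventually_nhds_iff_ball.1 (h.and (hΩ.eventually_mem ha))
    refine not_eventually_const_of_injOn hΩ hinj ha (f a)
      (mem_of_superset (ball_mem_nhds a hρ) fun w hw ↦ ?_)
    exact isOpen_ball.is_const_of_fderiv_eq_zero (𝕜 := ℂ) (convex_ball a ρ).isPreconnected
      (fun z hz ↦ ((hf z (hb z hz).2).differentiableAt).differentiableWithinAt)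
      (fun z hz ↦ hJz z (hb z hz).2 (hb z hz).1) hw (mem_ball_self hρ)
  obtain ⟨v, hv⟩ := exists_line_not_eventually_zero (hJ a ha) hJne
  -- In the plane through `a` spanned by `u` and `v`, the zero set of `J` contains a graph over the
  -- `u` direction. Distinct parameters give distinct points of it because `u` and `v` are
  -- independent, yet `f` is constant along it.
  obtain ⟨u, hu⟩ : ∃ u : E, u ∉ Submodule.span ℂ {v} := by
    by_contra! h
    have h1 : Module.finrank ℂ (Submodule.span ℂ {v}) ≤ 1 :=
      (finrank_span_le_card (R := ℂ) ({v} : Set E)).trans (by simp)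
    rw [(Submodule.eq_top_iff'.2 h), finrank_top] at h1
    omega
  let P : ℂ × ℂ → E := fun p ↦ a + p.1 • u + p.2 • v
  have hP0 : P 0 = a := by simp [P]
  have hPan : AnalyticAt ℂ P 0 :=
    (analyticAt_const.add (analyticAt_fst.smul analyticAt_const)).add
      (analyticAt_snd.smul analyticAt_const)
  obtain ⟨s₀, h, hgraph⟩ := exists_zero_graph (j := fun p ↦ J (P p)) (N := P ⁻¹' Ω)
    ((show Continuous P by fun_prop).continuousAt.preimage_mem_nhds
      (hP0 ▸ hΩ.mem_nhds ha))
    ((hP0 ▸ hJ a ha : AnalyticAt ℂ J (P 0)).fun_comp (f := P) hPan)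
    (by rw [hP0, hJa]) (by simpa [P] using hv)
  have hder : ∀ᶠ s in 𝓝 s₀, HasDerivAt (fun s ↦ f (P (s, h s))) 0 s := by
    filter_upwards [hgraph] with s ⟨hd, hjs, hsΩ⟩
    have hp : DifferentiableAt ℂ (fun s ↦ P (s, h s)) s := by fun_prop
    have hfd := (hf _ hsΩ).differentiableAt.hasFDerivAt
    rw [hJz _ hsΩ hjs] at hfd
    simpa [Function.comp_def] using hfd.comp_hasDerivAt s hp.hasDerivAt
  obtain ⟨δ, hδ, hb⟩ := Metric.eventually_nhds_iff_ball.1 (hgraph.and hder)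
  have hconst : ∀ s ∈ ball s₀ δ, f (P (s, h s)) = f (P (s₀, h s₀)) := fun s hs ↦
    isOpen_ball.is_const_of_deriv_eq_zero (convex_ball s₀ δ).isPreconnected
      (fun z hz ↦ (hb z hz).2.differentiableAt.differentiableWithinAt)
      (fun z hz ↦ (hb z hz).2.deriv) hs (mem_ball_self hδ)
  have hs1 : s₀ + (δ / 2 : ℝ) ∈ ball s₀ δ := by
    rw [mem_ball, dist_eq_norm, add_sub_cancel_left, Complex.norm_real, Real.norm_eq_abs,
      abs_of_pos (by positivity)]
    linarith
  have heq := hinj (hb _ hs1).1.2.2 (hb _ (mem_ball_self hδ)).1.2.2 (hconst _ hs1)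
  simp only [P] at heq
  have hδ' : ((δ / 2 : ℝ) : ℂ) ≠ 0 := by exact_mod_cast (by positivity : δ / 2 ≠ 0)
  have hmem : ((δ / 2 : ℝ) : ℂ) • u ∈ Submodule.span ℂ {v} := by
    rw [Submodule.mem_span_singleton]
    refine ⟨h s₀ - h (s₀ + (δ / 2 : ℝ)), ?_⟩
    rw [add_smul] at heq
    rw [sub_smul, sub_eq_iff_eq_add]
    have h3 : a + s₀ • u + (((δ / 2 : ℝ) : ℂ) • u + h (s₀ + ((δ / 2 : ℝ) : ℂ)) • v) =
        a + s₀ • u + h s₀ • v := by rw [← heq]; abel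
    exact (add_left_cancel h3).symm
  exact hu ((Submodule.smul_mem_iff _ hδ').1 hmem)

/-- Near a point where `ℓ ∘ f` is submersive, an injective holomorphic map `f` induces an injective
holomorphic map between the kernels of `ℓ ∘ f'(a)` and of `ℓ`. -/
theorem exists_injOn_ker {E : Type u} {F : Type v} [NormedAddCommGroup E] [NormedSpace ℂ E]
    [FiniteDimensional ℂ E] [NormedAddCommGroup F] [NormedSpace ℂ F] [FiniteDimensional ℂ F]
    {f : E → F} {Ω : Set E} (hΩ : IsOpen Ω) (hf : AnalyticOnNhd ℂ f Ω) (hinj : InjOn f Ω)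
    {a : E} (ha : a ∈ Ω) (l : F →L[ℂ] ℂ) {v₀ : E} (hv₀ : l (fderiv ℂ f a v₀) = 1) :
    ∃ (g : (l ∘L fderiv ℂ f a).ker → l.ker) (W : Set (l ∘L fderiv ℂ f a).ker),
      IsOpen W ∧ AnalyticOnNhd ℂ g W ∧ InjOn g W ∧ 0 ∈ W ∧
        ∀ x, ((fderiv ℂ g 0 x : l.ker) : F) = fderiv ℂ f a x := by
  have : CompleteSpace E := FiniteDimensional.complete ℂ E
  set A := fderiv ℂ f a
  set m : E →L[ℂ] ℂ := l ∘L A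
  have hmv : m v₀ = 1 := hv₀
  -- `T` straightens the level set of `l ∘ f` through `a` onto `ker m`: `m (T x) = l (f x) - l (f
  -- a)` because `m v₀ = 1`, and the derivative of `T` at `a` is the identity.
  let T : E → E := fun x ↦ (x - a) + (l (f x) - l (f a) - m (x - a)) • v₀
  have hTan : AnalyticAt ℂ T a := by
    have h1 : AnalyticAt ℂ (fun x ↦ l (f x)) a := (l.analyticAt _).fun_comp (hf a ha)
    have h2 : AnalyticAt ℂ (fun x ↦ m (x - a)) a := (m.analyticAt _).fun_comp (by fun_prop)
    exact (by fun_prop : AnalyticAt ℂ (fun x : E ↦ x - a) a).add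
      (((h1.sub analyticAt_const).sub h2).smul analyticAt_const)
  have hTd : HasFDerivAt T ((ContinuousLinearEquiv.refl ℂ E : E ≃L[ℂ] E) : E →L[ℂ] E) a := by
    have hfd : HasFDerivAt f A a := (hf a ha).differentiableAt.hasFDerivAt
    have h1 : HasFDerivAt (fun x ↦ l (f x)) m a := l.hasFDerivAt.comp a hfd
    have h0 : HasFDerivAt (fun x : E ↦ x - a) (.id ℂ E) a := (hasFDerivAt_id a).sub_const a
    have h2 : HasFDerivAt (fun x ↦ m (x - a)) m a := m.hasFDerivAt.comp a h0
    have h3 := h0.add (((h1.sub_const (l (f a))).sub h2).smul_const v₀)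
    refine h3.congr_fderiv ?_
    ext x
    simp
  have hmT : ∀ x, m (T x) = l (f x) - l (f a) := by
    intro x
    simp only [T, map_add, map_smul, hmv, smul_eq_mul]
    ring
  have hcd : ContDiffAt ℂ ω T a := hTan.contDiffAt
  have hTa : T a = 0 := by simp [T]
  let Θ := hcd.toOpenPartialHomeomorph T hTd (by simp)
  have hsrc : a ∈ Θ.source := hcd.mem_toOpenPartialHomeomorph_source hTd (by simp)
  have htgt : (0 : E) ∈ Θ.target := by
    rw [← hTa]
    exact hcd.image_mem_toOpenPartialHomeomorph_target hTd (by simp)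
  have hΘT : ∀ y ∈ Θ.target, T (Θ.symm y) = y := fun y hy ↦ Θ.right_inv hy
  have hS0 : Θ.symm 0 = a := by
    have := Θ.left_inv hsrc
    rwa [show Θ a = 0 from hTa] at this
  have hSan : AnalyticAt ℂ Θ.symm 0 := by
    refine (Θ.contDiffAt_symm (n := ω) htgt (f₀' := .refl ℂ E) ?_ ?_).analyticAt
    · rw [hS0]; exact hTd
    · rw [hS0]; exact hcd
  have hSd : HasFDerivAt Θ.symm (.id ℂ E) 0 :=
    Θ.hasFDerivAt_symm htgt (f' := .refl ℂ E) (by rw [hS0]; exact hTd)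
  -- The projection `p` only serves to land in the subtype: `G` already takes values in `ker l` on
  -- `W`.
  obtain ⟨p, hp⟩ : l.ker.ClosedComplemented := Submodule.ClosedComplemented.of_finiteDimensional _
  have hnhds : ∀ᶠ y in 𝓝 (0 : E), AnalyticAt ℂ Θ.symm y ∧ y ∈ Θ.target ∧ Θ.symm y ∈ Ω := by
    refine hSan.eventually_analyticAt.and ((Θ.open_target.eventually_mem htgt).and ?_)
    exact hSan.continuousAt.eventually_mem (by rw [hS0]; exact hΩ.mem_nhds ha)
  obtain ⟨ρ, hρ, hb⟩ := Metric.eventually_nhds_iff_ball.1 hnhds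
  let W : Set m.ker := (fun x : m.ker ↦ (x : E)) ⁻¹' ball 0 ρ
  let G : m.ker → F := fun x ↦ f (Θ.symm x) - f a
  have hGker : ∀ x ∈ W, G x ∈ l.ker := by
    intro x hx
    have h1 := hmT (Θ.symm x)
    rw [hΘT _ (hb _ hx).2.1] at h1
    simp only [G, LinearMap.mem_ker, ContinuousLinearMap.coe_coe, map_sub]
    rw [← h1]
    exact x.2
  have hpG : ∀ x ∈ W, ((p (G x) : l.ker) : F) = G x := fun x hx ↦
    congrArg Subtype.val (hp ⟨G x, hGker x hx⟩)
  refine ⟨fun x ↦ p (G x), W, isOpen_ball.preimage continuous_subtype_val, ?_, ?_, ?_, ?_⟩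
  · intro x hx
    have h1 : AnalyticAt ℂ (fun x : m.ker ↦ Θ.symm x) x :=
      (hb _ hx).1.fun_comp (f := fun x : m.ker ↦ (x : E)) (m.ker.subtypeL.analyticAt x)
    exact (p.analyticAt _).fun_comp
      (((hf _ (hb _ hx).2.2).fun_comp (f := fun x : m.ker ↦ Θ.symm x) h1).sub analyticAt_const)
  · intro x hx y hy hxy
    have h1 : G x = G y := by rw [← hpG x hx, ← hpG y hy]; exact congrArg _ hxy
    have h2 := hinj (hb _ hx).2.2 (hb _ hy).2.2 (sub_left_injective h1)
    refine Subtype.ext ?_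
    exact Θ.symm.injOn (hb _ hx).2.1 (hb _ hy).2.1 h2
  · simpa [W] using hρ
  · intro x
    have hsub : HasFDerivAt (fun x : m.ker ↦ (x : E)) m.ker.subtypeL 0 := m.ker.subtypeL.hasFDerivAt
    have h1 : HasFDerivAt (fun x : m.ker ↦ Θ.symm x) m.ker.subtypeL 0 :=
      HasFDerivAt.comp (0 : m.ker) (g := Θ.symm) (f := fun x : m.ker ↦ (x : E)) hSd hsub
    have h2 : HasFDerivAt G (A ∘L m.ker.subtypeL) 0 := by
      refine HasFDerivAt.sub_const _ (HasFDerivAt.comp (0 : m.ker) (g := f) ?_ h1)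
      rw [Submodule.coe_zero, hS0]
      exact (hf a ha).differentiableAt.hasFDerivAt
    have h3 : HasFDerivAt (fun x ↦ p (G x)) (p ∘L (A ∘L m.ker.subtypeL)) 0 :=
      p.hasFDerivAt.comp _ h2
    rw [h3.fderiv]
    exact congrArg Subtype.val (hp ⟨A x, x.2⟩)

/-- **Osgood's theorem**: an injective holomorphic map between spaces of the same finite dimension
has injective derivative. -/
theorem fderiv_injective_of_injOn {E : Type u} {F : Type v} [NormedAddCommGroup E]
    [NormedSpace ℂ E] [FiniteDimensional ℂ E] [NormedAddCommGroup F] [NormedSpace ℂ F]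
    [FiniteDimensional ℂ F] (hEF : Module.finrank ℂ E = Module.finrank ℂ F)
    {f : E → F} {Ω : Set E} (hΩ : IsOpen Ω) (hf : AnalyticOnNhd ℂ f Ω) (hinj : InjOn f Ω)
    {a : E} (ha : a ∈ Ω) : Function.Injective (fderiv ℂ f a) := by
  induction hn : Module.finrank ℂ E generalizing E F with
  | zero =>
    have := Module.finrank_zero_iff.1 hn
    exact Function.injective_of_subsingleton _
  | succ n ih =>
    -- If `f'(z) ≠ 0`, choose `l` with `l ∘ f'(z) ≠ 0`. The kernel of `f'(z)` lies in that of `l ∘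
    -- f'(z)`, where the induction hypothesis gives injectivity.
    have hsing : ∀ z ∈ Ω, ¬ Function.Injective (fderiv ℂ f z) → fderiv ℂ f z = 0 := by
      intro z hz hni
      by_contra hne
      obtain ⟨v, hv⟩ : ∃ v, fderiv ℂ f z v ≠ 0 := by
        by_contra! h
        exact hne (ContinuousLinearMap.ext h)
      obtain ⟨l, hl⟩ := SeparatingDual.exists_eq_one (R := ℂ) hv
      obtain ⟨g, W, hW, hgan, hginj, h0W, hgd⟩ := exists_injOn_ker hΩ hf hinj hz l hl
      have hk1 : Module.finrank ℂ (l ∘L fderiv ℂ f z).ker = n := by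
        have hsurj : (l ∘L fderiv ℂ f z).toLinearMap ≠ 0 := fun h ↦ by
          have := LinearMap.congr_fun h v
          simp [hl] at this
        have := Module.Dual.finrank_ker_add_one_of_ne_zero hsurj
        omega
      have hk2 : Module.finrank ℂ l.ker = n := by
        have hsurj : l.toLinearMap ≠ 0 := fun h ↦ by
          have := LinearMap.congr_fun h (fderiv ℂ f z v)
          simp [hl] at this
        have := Module.Dual.finrank_ker_add_one_of_ne_zero hsurj
        omega
      have hgi := ih (hk1.trans hk2.symm) hW hgan hginj h0W hk1
      refine hni ((injective_iff_map_eq_zero _).2 fun x hx ↦ ?_)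
      have hxk : x ∈ (l ∘L fderiv ℂ f z).ker := by simp [hx]
      have : (⟨x, hxk⟩ : (l ∘L fderiv ℂ f z).ker) = 0 := hgi <| by
        refine Subtype.ext ?_
        rw [hgd, map_zero]
        exact hx
      exact congrArg Subtype.val this
    by_contra hni
    have hfa := hsing a ha hni
    -- `n = 0` is dimension one, where no second direction is available and the one-variable theorem
    -- applies.
    rcases Nat.eq_zero_or_pos n with rfl | hpos
    · let e : ℂ ≃L[ℂ] E := ContinuousLinearEquiv.ofFinrankEq (by simpa using hn.symm)
      let e' : F ≃L[ℂ] ℂ := ContinuousLinearEquiv.ofFinrankEq (by simpa using hEF.symm.trans hn)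
      have hd := deriv_ne_zero_of_injOn (f := fun s ↦ e' (f (e s))) (Ω := e ⁻¹' Ω)
        (hΩ.preimage e.continuous)
        (fun s hs ↦ (e'.analyticAt _).fun_comp ((hf _ hs).fun_comp (e.analyticAt s)))
        (fun s hs t ht hst ↦ e.injective (hinj hs ht (e'.injective hst)))
        (a := e.symm a) (by simpa using ha)
      refine hd (HasDerivAt.deriv ?_)
      have h1 : HasFDerivAt f (0 : E →L[ℂ] F) (e (e.symm a)) := by
        rw [e.apply_symm_apply, ← hfa]
        exact (hf a ha).differentiableAt.hasFDerivAt
      have h2 := (e'.hasFDerivAt.comp _ (h1.comp _ e.hasFDerivAt)).hasDerivAt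
      simpa [Function.comp_def] using h2
    · exact fderiv_ne_zero_of_injOn hEF (by omega) hΩ hf hinj hsing ha hfa

/-! ### The Levi form, its naturality, and eigenvalue counts. -/

section Levi

open scoped ComplexOrder

variable {n : ℕ}

/-- Four times the Levi form of `u` at `z`, as a real quadratic form. -/
noncomputable def leviForm (u : Cn n → ℝ) (z v : Cn n) : ℝ :=
  realHessian u z v v + realHessian u z (Complex.I • v) (Complex.I • v)

theorem Filter.EventuallyEq.realHessian_eq {u w : Cn n → ℝ} {z : Cn n} (h : u =ᶠ[𝓝 z] w) :
    realHessian u z = realHessian w z := by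
  funext v v'
  rw [realHessian, realHessian, (h.fderiv (𝕜 := ℝ)).fderiv_eq]

theorem Filter.EventuallyEq.leviForm_eq {u w : Cn n → ℝ} {z : Cn n} (h : u =ᶠ[𝓝 z] w) :
    leviForm u z = leviForm w z := by
  funext v
  rw [leviForm, leviForm, h.realHessian_eq]

theorem Filter.EventuallyEq.leviMatrix_eq {u w : Cn n → ℝ} {z : Cn n} (h : u =ᶠ[𝓝 z] w) :
    leviMatrix u z = leviMatrix w z := by
  simp only [leviMatrix, h.realHessian_eq]

theorem realHessian_comm {u : Cn n → ℝ} {z : Cn n} (hu : ContDiffAt ℝ 2 u z) (v w : Cn n) :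
    realHessian u z v w = realHessian u z w v :=
  (hu.isSymmSndFDerivAt (by simp)).eq v w

/-- The second derivative of `F` enters complex bilinearly, so its contributions at `(v, v)` and `(I
• v, I • v)` cancel in `leviForm_comp`. -/
theorem realHessian_comp {u : Cn n → ℝ} {F : Cn n → Cn n} {z : Cn n}
    (hu : ContDiffAt ℝ 2 u (F z)) (hF : ContDiffAt ℂ 2 F z) (v w : Cn n) :
    realHessian (u ∘ F) z v w = fderiv ℝ u (F z) (fderiv ℂ (fderiv ℂ F) z v w) +
      realHessian u (F z) (fderiv ℂ F z v) (fderiv ℂ F z w) := by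
  have hFd : ∀ᶠ y in 𝓝 z, DifferentiableAt ℂ F y :=
    (hF.eventually (by simp)).mono fun y hy ↦ hy.differentiableAt (by simp)
  have hud : ∀ᶠ y in 𝓝 z, DifferentiableAt ℝ u (F y) :=
    (hF.continuousAt.eventually (hu.eventually (by simp))).mono
      fun y hy ↦ hy.differentiableAt (by simp)
  have huf : ContDiffAt ℝ 2 (u ∘ F) z := hu.comp z (hF.restrict_scalars ℝ)
  have h1 : HasFDerivAt (fun y ↦ fderiv ℝ (u ∘ F) y w)
      ((fderiv ℝ (fderiv ℝ (u ∘ F)) z).flip w) z := by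
    have := ((huf.fderiv_right (m := 1) (by norm_num)).differentiableAt (by simp)).hasFDerivAt
    simpa using this.clm_apply (hasFDerivAt_const w z)
  have hd : HasFDerivAt (fun y ↦ fderiv ℂ F y w)
      (((fderiv ℂ (fderiv ℂ F) z).flip w).restrictScalars ℝ) z := by
    have := ((hF.fderiv_right (m := 1) (by norm_num)).differentiableAt (by simp)).hasFDerivAt
    simpa using (this.clm_apply (hasFDerivAt_const w z)).restrictScalars ℝ
  have hFz : HasFDerivAt F ((fderiv ℂ F z).restrictScalars ℝ) z :=
    hFd.self_of_nhds.hasFDerivAt.restrictScalars ℝ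
  have hc : HasFDerivAt (fun y ↦ fderiv ℝ u (F y))
      ((fderiv ℝ (fderiv ℝ u) (F z)).comp ((fderiv ℂ F z).restrictScalars ℝ)) z :=
    HasFDerivAt.comp z (g := fderiv ℝ u)
      ((hu.fderiv_right (m := 1) (by norm_num)).differentiableAt (by simp)).hasFDerivAt hFz
  have h2 := hc.clm_apply hd
  have heq : (fun y ↦ fderiv ℝ (u ∘ F) y w) =ᶠ[𝓝 z]
      fun y ↦ fderiv ℝ u (F y) (fderiv ℂ F y w) := by
    filter_upwards [hFd, hud] with y hy1 hy2
    rw [(hy2.hasFDerivAt.comp y (hy1.hasFDerivAt.restrictScalars ℝ)).fderiv]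
    rfl
  have h3 := congrArg (fun L ↦ L v) (h1.unique (h2.congr_of_eventuallyEq heq))
  simpa [realHessian] using h3

/-- The Levi form is natural under holomorphic maps. -/
theorem leviForm_comp {u : Cn n → ℝ} {F : Cn n → Cn n} {z : Cn n}
    (hu : ContDiffAt ℝ 2 u (F z)) (hF : ContDiffAt ℂ 2 F z) (v : Cn n) :
    leviForm (u ∘ F) z v = leviForm u (F z) (fderiv ℂ F z v) := by
  rw [leviForm, leviForm, realHessian_comp hu hF, realHessian_comp hu hF]
  simp only [map_smul, smul_apply, smul_smul, Complex.I_mul_I, neg_smul,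
    one_smul, map_neg]
  ring

theorem realHessian_eq_of_hasDerivAt {u : Cn n → ℝ} {z v : Cn n} (hu : ContDiffAt ℝ 2 u z)
    {d : ℝ → ℝ} {c : ℝ} (hd : ∀ s, HasDerivAt (fun s : ℝ ↦ u (z + s • v)) (d s) s)
    (hc : HasDerivAt d c 0) : realHessian u z v v = c := by
  let γ : ℝ → Cn n := fun s ↦ z + s • v
  have hγ : ∀ s, HasDerivAt γ v s := fun s ↦ by
    simpa [γ] using ((hasDerivAt_id s).smul_const v).const_add z
  have hγ0 : γ 0 = z := by simp [γ]
  have hud : ∀ᶠ s in 𝓝 (0 : ℝ), DifferentiableAt ℝ u (γ s) := by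
    refine (hγ 0).continuousAt.eventually (p := fun y ↦ DifferentiableAt ℝ u y) ?_
    rw [hγ0]
    exact (hu.eventually (by simp)).mono fun y hy ↦ hy.differentiableAt (by simp)
  have heq : (fun s ↦ fderiv ℝ u (γ s) v) =ᶠ[𝓝 0] d := by
    filter_upwards [hud] with s hs
    exact (hs.hasFDerivAt.comp_hasDerivAt s (hγ s)).unique (hd s)
  have h1 : HasFDerivAt (fderiv ℝ u) (fderiv ℝ (fderiv ℝ u) z) (γ 0) := by
    rw [hγ0]
    exact ((hu.fderiv_right (m := 1) (by norm_num)).differentiableAt (by simp)).hasFDerivAt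
  have h2 := (h1.comp_hasDerivAt 0 (hγ 0)).clm_apply (hasDerivAt_const (0 : ℝ) v)
  have h3 := h2.unique (hc.congr_of_eventuallyEq heq)
  simpa [realHessian] using h3

/-- The sesquilinear form whose matrix is four times the Levi matrix. -/
noncomputable def leviSesq (u : Cn n → ℝ) (z : Cn n) : Cn n →ₗ[ℂ] Cn n →ₗ⋆[ℂ] ℂ :=
  LinearMap.mk₂'ₛₗ (RingHom.id ℂ) (starRingEnd ℂ)
    (fun v w ↦ ((realHessian u z v w + realHessian u z (Complex.I • v) (Complex.I • w) : ℝ) : ℂ) +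
      Complex.I * ((realHessian u z v (Complex.I • w) - realHessian u z (Complex.I • v) w : ℝ) : ℂ))
    (fun v v' w ↦ by
      simp only [realHessian, smul_add, map_add, add_apply]
      push_cast; ring)
    (fun c v w ↦ by
      have hs : ∀ x : Cn n, c • x = c.re • x + c.im • Complex.I • x := fun x ↦ by
        conv_lhs => rw [← Complex.re_add_im c, add_smul, mul_smul]
        rfl
      have hs' : ∀ x : Cn n, Complex.I • c • x = c.re • Complex.I • x - c.im • x := fun x ↦ by
        rw [smul_comm, hs, smul_smul, Complex.I_mul_I, neg_one_smul, smul_neg, sub_eq_add_neg]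
      simp only [hs', realHessian]
      simp only [hs v, map_add, map_sub, map_smul, add_apply,
        sub_apply, smul_apply, smul_eq_mul,
        RingHom.id_apply]
      apply Complex.ext <;> simp <;> ring)
    (fun v w w' ↦ by
      simp only [realHessian, smul_add, map_add]
      push_cast; ring)
    (fun c v w ↦ by
      have hs : ∀ x : Cn n, c • x = c.re • x + c.im • Complex.I • x := fun x ↦ by
        conv_lhs => rw [← Complex.re_add_im c, add_smul, mul_smul]
        rfl
      have hs' : ∀ x : Cn n, Complex.I • c • x = c.re • Complex.I • x - c.im • x := fun x ↦ by
        rw [smul_comm, hs, smul_smul, Complex.I_mul_I, neg_one_smul, smul_neg, sub_eq_add_neg]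
      simp only [hs', realHessian]
      simp only [hs w, map_add, map_sub, map_smul, smul_eq_mul]
      apply Complex.ext <;> simp <;> ring)

theorem leviSesq_apply (u : Cn n → ℝ) (z v w : Cn n) : leviSesq u z v w =
    ((realHessian u z v w + realHessian u z (Complex.I • v) (Complex.I • w) : ℝ) : ℂ) +
      Complex.I * ((realHessian u z v (Complex.I • w) - realHessian u z (Complex.I • v) w : ℝ) : ℂ) :=
  rfl

theorem leviSesq_self {u : Cn n → ℝ} {z : Cn n} (hu : ContDiffAt ℝ 2 u z) (v : Cn n) :
    leviSesq u z v v = leviForm u z v := by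
  rw [leviSesq_apply, realHessian_comm hu v (Complex.I • v), leviForm]
  simp

theorem leviMatrix_apply (u : Cn n → ℝ) (z : Cn n) (j k : Fin n) : leviMatrix u z j k =
    (1 / 4 : ℂ) * leviSesq u z (EuclideanSpace.single j 1) (EuclideanSpace.single k 1) := by
  have h : ∀ i : Fin n, Complex.I • (EuclideanSpace.single i (1 : ℂ) : Cn n) =
      EuclideanSpace.single i Complex.I := fun i ↦ by
    ext l; simp
  rw [leviSesq_apply, h, h]
  rfl

theorem isHermitian_leviMatrix {u : Cn n → ℝ} {z : Cn n} (hu : ContDiffAt ℝ 2 u z) :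
    (leviMatrix u z).IsHermitian := by
  refine Matrix.IsHermitian.ext fun j k ↦ ?_
  rw [leviMatrix_apply, leviMatrix_apply, leviSesq_apply, leviSesq_apply]
  generalize (EuclideanSpace.single j (1 : ℂ) : Cn n) = a
  generalize (EuclideanSpace.single k (1 : ℂ) : Cn n) = b
  rw [realHessian_comm hu b a, realHessian_comm hu (Complex.I • b),
    realHessian_comm hu b, realHessian_comm hu (Complex.I • b)]
  apply Complex.ext <;> simp

/-- The conjugate of `x` appears because `leviSesq` is linear in its first argument and conjugate
linear in its second. -/
theorem star_dotProduct_leviMatrix_mulVec {u : Cn n → ℝ} {z : Cn n} (hu : ContDiffAt ℝ 2 u z)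
    (x : Fin n → ℂ) : star x ⬝ᵥ (leviMatrix u z).mulVec x =
      ((leviForm u z (WithLp.toLp 2 (star x)) / 4 : ℝ) : ℂ) := by
  have hx : (WithLp.toLp 2 (star x) : Cn n) =
      ∑ j, star (x j) • EuclideanSpace.single j (1 : ℂ) := by
    ext l
    simp [Finset.sum_apply, Pi.single_apply]
  have h1 := leviSesq_self hu (WithLp.toLp 2 (star x))
  rw [Complex.ofReal_div, ← h1, hx]
  simp only [map_sum, LinearMap.sum_apply, map_smul, LinearMap.smul_apply, LinearMap.map_smulₛₗ,
    dotProduct, Matrix.mulVec, leviMatrix_apply, Pi.star_apply, smul_eq_mul, Finset.sum_div,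
    Finset.mul_sum, RCLike.star_def, Complex.conj_conj]
  rw [Finset.sum_comm]
  refine Finset.sum_congr rfl fun j _ ↦ Finset.sum_congr rfl fun k _ ↦ ?_
  push_cast
  ring

theorem posSemidef_leviMatrix {u : Cn n → ℝ} {z : Cn n} (hu : ContDiffAt ℝ 2 u z)
    (hpos : ∀ v, 0 ≤ leviForm u z v) : (leviMatrix u z).PosSemidef := by
  refine Matrix.PosSemidef.of_dotProduct_mulVec_nonneg (isHermitian_leviMatrix hu) fun x ↦ ?_
  rw [star_dotProduct_leviMatrix_mulVec hu]
  exact Complex.zero_le_real.2 (div_nonneg (hpos _) (by norm_num))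

theorem ncard_leviMatrix_neg_lt {u : Cn n → ℝ} {z : Cn n} (hu : ContDiffAt ℝ 2 u z)
    (hpos : ∀ v, 0 ≤ leviForm u z v) {q : ℕ} (hq : 1 ≤ q) :
    ∃ h : (leviMatrix u z).IsHermitian, {i | h.eigenvalues i < 0}.ncard < q := by
  refine ⟨isHermitian_leviMatrix hu, ?_⟩
  rw [show {i | (isHermitian_leviMatrix hu).eigenvalues i < 0} = ∅ from
    eq_empty_of_forall_notMem fun i hi ↦
      not_le.2 hi ((posSemidef_leviMatrix hu hpos).eigenvalues_nonneg i), ncard_empty]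
  exact hq

/-- Nonpositive eigenvalues of a semidefinite matrix are zero. The conjugates of their eigenvectors
are orthonormal null vectors of the Levi form, so they are independent in `K` and number at most
`dim K`. -/
theorem ncard_leviMatrix_nonpos_lt {u : Cn n → ℝ} {z : Cn n} (hu : ContDiffAt ℝ 2 u z)
    (hpos : ∀ v, 0 ≤ leviForm u z v) {q : ℕ} {K : Submodule ℂ (Cn n)}
    (hK : Module.finrank ℂ K < q) (hzero : ∀ v, leviForm u z v = 0 → v ∈ K) :
    ∃ h : (leviMatrix u z).IsHermitian, {i | h.eigenvalues i ≤ 0}.ncard < q := by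
  have h := isHermitian_leviMatrix hu
  refine ⟨h, lt_of_le_of_lt ?_ hK⟩
  let b := h.eigenvectorBasis
  let y : Fin n → Cn n := fun i ↦ WithLp.toLp 2 (star (b i).ofLp)
  have hy : Orthonormal ℂ y := by
    have hb := orthonormal_iff_ite.1 b.orthonormal
    refine orthonormal_iff_ite.2 fun i j ↦ ?_
    have : inner ℂ (y i) (y j) = starRingEnd ℂ (inner ℂ (b i) (b j)) := by
      simp [y, PiLp.inner_apply, mul_comm]
    rw [this, hb]
    split_ifs <;> simp
  have hyK : ∀ i : {i | h.eigenvalues i ≤ 0}, y i ∈ K := by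
    rintro ⟨i, hi⟩
    have h0 : h.eigenvalues i = 0 :=
      le_antisymm hi ((posSemidef_leviMatrix hu hpos).eigenvalues_nonneg i)
    refine hzero _ ?_
    have h1 := star_dotProduct_leviMatrix_mulVec hu (b i).ofLp
    rw [h.mulVec_eigenvectorBasis, h0, zero_smul, dotProduct_zero] at h1
    have h2 := Complex.ofReal_eq_zero.1 h1.symm
    simpa [y] using h2
  have hli : LinearIndependent ℂ (fun i : {i | h.eigenvalues i ≤ 0} ↦ (⟨y i, hyK i⟩ : K)) := by
    refine LinearIndependent.of_comp K.subtype ?_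
    exact hy.linearIndependent.comp _ Subtype.val_injective
  have := hli.fintype_card_le_finrank
  rwa [← Nat.card_eq_fintype_card] at this

end Levi

/-! ### The model function and the lower bound for its Levi form. -/

theorem hasDerivAt_max_zero_pow (m : ℕ) (s : ℝ) :
    HasDerivAt (fun s : ℝ ↦ max s 0 ^ (m + 2)) ((m + 2) * max s 0 ^ (m + 1)) s := by
  have hpow : HasDerivAt (fun s : ℝ ↦ s ^ (m + 2)) ((m + 2) * s ^ (m + 1)) s := by
    simpa using hasDerivAt_pow (m + 2) s
  rcases lt_trichotomy s 0 with hs | rfl | hs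
  · rw [max_eq_right hs.le, zero_pow (by omega), mul_zero]
    refine (hasDerivAt_const s (0 : ℝ)).congr_of_eventuallyEq ?_
    filter_upwards [gt_mem_nhds hs] with x hx
    rw [max_eq_right hx.le, zero_pow (by omega)]
  · rw [max_self]
    rw [← hasDerivWithinAt_univ, ← Iic_union_Ici (a := (0 : ℝ))]
    refine HasDerivWithinAt.union ?_ ?_
    · rw [zero_pow (by omega), mul_zero]
      refine (hasDerivWithinAt_const (0 : ℝ) _ (0 : ℝ)).congr (fun x hx ↦ ?_) (by simp)
      rw [max_eq_right (mem_Iic.1 hx), zero_pow (by omega)]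
    · refine hpow.hasDerivWithinAt.congr (fun x hx ↦ ?_) (by simp)
      rw [max_eq_left (mem_Ici.1 hx)]
  · rw [max_eq_left hs.le]
    refine hpow.congr_of_eventuallyEq ?_
    filter_upwards [lt_mem_nhds hs] with x hx
    rw [max_eq_left hx.le]

theorem contDiff_max_zero_pow_four : ContDiff ℝ 2 (fun s : ℝ ↦ max s 0 ^ 4) := by
  have h4 := fun s ↦ (hasDerivAt_max_zero_pow 2 s)
  have h3 := fun s ↦ (hasDerivAt_max_zero_pow 1 s)
  have h1 : ContDiff ℝ 1 (fun s : ℝ ↦ max s 0 ^ 3) := by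
    rw [contDiff_one_iff_deriv]
    refine ⟨fun s ↦ (h3 s).differentiableAt, ?_⟩
    rw [show deriv (fun s : ℝ ↦ max s 0 ^ 3) = _ from funext fun s ↦ (h3 s).deriv]
    fun_prop
  rw [show (2 : WithTop ℕ∞) = 1 + 1 by norm_num, contDiff_succ_iff_deriv]
  refine ⟨fun s ↦ (h4 s).differentiableAt, by simp, ?_⟩
  rw [show deriv (fun s : ℝ ↦ max s 0 ^ 4) = _ from funext fun s ↦ (h4 s).deriv]
  exact contDiff_const.mul h1

section Model

variable {k n : ℕ}

/-- `headCoords` as a linear map. -/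
noncomputable def headCoordsL (hk : k ≤ n) : Cn n →L[ℂ] Cn k :=
  LinearMap.toContinuousLinearMap
    { toFun := headCoords hk
      map_add' := fun _ _ ↦ rfl
      map_smul' := fun _ _ ↦ rfl }

theorem headCoordsL_apply (hk : k ≤ n) (z : Cn n) : headCoordsL hk z = headCoords hk z := rfl

theorem continuous_headCoords (hk : k ≤ n) : Continuous (headCoords hk) :=
  (headCoordsL hk).continuous

theorem headCoordsL_surjective (hk : k ≤ n) : Function.Surjective (headCoordsL hk) := by
  intro y
  refine ⟨WithLp.toLp 2 fun i ↦ if h : i.1 < k then y ⟨i.1, h⟩ else 0, ?_⟩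
  ext i
  simp [headCoordsL_apply, headCoords]

variable [NeZero k]

/-- The function `(Re z₁ - r)₊⁴ (2 + ‖z'‖²)`, where `z'` are the first `k` coordinates of `z`. -/
noncomputable def hatModel (hk : k ≤ n) (r : ℝ) (z : Cn n) : ℝ :=
  max ((headCoords hk z 0).re - r) 0 ^ 4 * (2 + ‖headCoords hk z‖ ^ 2)

theorem contDiff_hatModel (hk : k ≤ n) (r : ℝ) : ContDiff ℝ 2 (hatModel hk r) := by
  have hhead : ContDiff ℝ 2 (headCoords hk) :=
    ((headCoordsL hk).restrictScalars ℝ).contDiff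
  have h1 : ContDiff ℝ 2 fun z ↦ (headCoords hk z 0).re - r :=
    (((Complex.reCLM ∘L (((EuclideanSpace.proj 0 : Cn k →L[ℂ] ℂ) ∘L
      headCoordsL hk).restrictScalars ℝ))).contDiff).sub contDiff_const
  exact (contDiff_max_zero_pow_four.comp h1).mul (contDiff_const.add (hhead.norm_sq ℂ))

theorem realHessian_hatModel (hk : k ≤ n) (r : ℝ) (z v : Cn n) :
    realHessian (hatModel hk r) z v v =
      12 * max ((headCoords hk z 0).re - r) 0 ^ 2 * (headCoords hk v 0).re ^ 2 *
        (2 + ‖headCoords hk z‖ ^ 2) +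
      16 * max ((headCoords hk z 0).re - r) 0 ^ 3 * (headCoords hk v 0).re *
        (inner ℂ (headCoords hk z) (headCoords hk v)).re +
      2 * max ((headCoords hk z 0).re - r) 0 ^ 4 * ‖headCoords hk v‖ ^ 2 := by
  set t := (headCoords hk z 0).re - r
  set α := (headCoords hk v 0).re
  set N := ‖headCoords hk z‖ ^ 2
  set β := (inner ℂ (headCoords hk z) (headCoords hk v)).re
  set A := ‖headCoords hk v‖ ^ 2
  have hline : (fun s : ℝ ↦ hatModel hk r (z + s • v)) =
      fun s ↦ max (t + s * α) 0 ^ 4 * (2 + (N + 2 * (s * β) + s ^ 2 * A)) := by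
    funext s
    have h1 : headCoords hk (z + s • v) = headCoords hk z + s • headCoords hk v := rfl
    have h2 : ‖headCoords hk z + s • headCoords hk v‖ ^ 2 = N + 2 * (s * β) + s ^ 2 * A := by
      rw [norm_add_sq (𝕜 := ℂ), norm_smul, mul_pow, Real.norm_eq_abs, sq_abs]
      have : inner ℂ (headCoords hk z) (s • headCoords hk v) =
          (s : ℂ) * inner ℂ (headCoords hk z) (headCoords hk v) :=
        inner_smul_right (𝕜 := ℂ) _ _ (s : ℂ)
      rw [this]
      simp [β, N, A]
    have h3 : ((headCoords hk z + s • headCoords hk v) 0).re - r = t + s * α := by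
      simp [t, α]; ring
    rw [hatModel, h1, h2, h3]
  have hlin : ∀ s, HasDerivAt (fun s : ℝ ↦ t + s * α) α s := fun s ↦ by
    simpa using ((hasDerivAt_id s).mul_const α).const_add t
  have hp : ∀ (m : ℕ) s, HasDerivAt (fun s : ℝ ↦ max (t + s * α) 0 ^ (m + 2))
      ((m + 2) * max (t + s * α) 0 ^ (m + 1) * α) s := fun m s ↦
    HasDerivAt.comp (h₂ := fun s : ℝ ↦ max s 0 ^ (m + 2)) s
      (hasDerivAt_max_zero_pow m (t + s * α)) (hlin s)
  have hN : ∀ s, HasDerivAt (fun s : ℝ ↦ 2 + (N + 2 * (s * β) + s ^ 2 * A))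
      (2 * β + 2 * s * A) s := fun s ↦ by
    have := ((((hasDerivAt_id s).mul_const β).const_mul 2).const_add N).add
      (((hasDerivAt_pow 2 s)).mul_const A)
    simpa using this.const_add 2
  have hN' : HasDerivAt (fun s : ℝ ↦ 2 * β + 2 * s * A) (2 * A) 0 := by
    simpa using (((hasDerivAt_id (0 : ℝ)).const_mul 2).mul_const A).const_add (2 * β)
  refine realHessian_eq_of_hasDerivAt ((contDiff_hatModel hk r).contDiffAt)
    (d := fun s ↦ (4 * max (t + s * α) 0 ^ 3 * α) * (2 + (N + 2 * (s * β) + s ^ 2 * A)) +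
      max (t + s * α) 0 ^ 4 * (2 * β + 2 * s * A)) ?_ ?_
  · intro s
    rw [hline]
    refine ((hp 2 s).mul (hN s)).congr_deriv ?_
    norm_num
  · have h3 := (((hp 1 0).const_mul 4).mul_const α).mul (hN 0)
    have h4 := (hp 2 0).mul hN'
    refine (h3.add h4).congr_deriv ?_
    norm_num
    ring

/-- Only the cross term can be negative. As `‖z'‖ ≤ 1`, it is at least `-16 m³ ‖c‖ ‖a‖`, which the
two square terms absorb. -/
theorem leviForm_hatModel_ge (hk : k ≤ n) (r : ℝ) {z : Cn n} (hz : ‖headCoords hk z‖ ≤ 1)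
    (v : Cn n) : max ((headCoords hk z 0).re - r) 0 ^ 4 * ‖headCoords hk v‖ ^ 2 ≤
      leviForm (hatModel hk r) z v := by
  have hI : headCoords hk (Complex.I • v) = Complex.I • headCoords hk v := rfl
  rw [leviForm, realHessian_hatModel, realHessian_hatModel, hI, inner_smul_right, norm_smul,
    Complex.norm_I, one_mul, PiLp.smul_apply, smul_eq_mul, Complex.I_mul_re, Complex.I_mul_re]
  set m := max ((headCoords hk z 0).re - r) 0
  have hm : 0 ≤ m := le_max_right _ _
  set c := headCoords hk v 0
  set h := headCoords hk z
  set a := headCoords hk v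
  set d := inner ℂ h a
  have hd : ‖d‖ ≤ ‖a‖ := (norm_inner_le_norm h a).trans
    (mul_le_of_le_one_left (norm_nonneg _) hz)
  have hre : -(‖c‖ * ‖a‖) ≤ c.re * d.re + c.im * d.im := by
    have h1 : (c * starRingEnd ℂ d).re = c.re * d.re + c.im * d.im := by simp
    have h2 := neg_le_of_abs_le (Complex.abs_re_le_norm (c * starRingEnd ℂ d))
    rw [norm_mul, Complex.norm_conj, h1] at h2
    nlinarith [norm_nonneg c, mul_le_mul_of_nonneg_left hd (norm_nonneg c)]
  have hc : c.re ^ 2 + c.im ^ 2 = ‖c‖ ^ 2 := by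
    rw [Complex.sq_norm, Complex.normSq_apply]; ring
  have h1 := mul_le_mul_of_nonneg_left hre (pow_nonneg hm 3)
  have h2 : 0 ≤ m ^ 2 * ‖c‖ ^ 2 * ‖h‖ ^ 2 := by positivity
  -- A third of this square gives `16 m³ ‖c‖ ‖a‖ ≤ 3 m⁴ ‖a‖² + (64/3) m² ‖c‖²`. The constant `2` in
  -- the model supplies `24 m² ‖c‖²`, and one of the four `m⁴ ‖a‖²` is left over.
  have h3 := sq_nonneg (3 * (m ^ 2 * ‖a‖) - 8 * (m * ‖c‖))
  have h4 := sq_nonneg (m * ‖c‖)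
  have hkey : 12 * m ^ 2 * c.re ^ 2 * (2 + ‖h‖ ^ 2) + 16 * m ^ 3 * c.re * d.re +
      2 * m ^ 4 * ‖a‖ ^ 2 + (12 * m ^ 2 * (-c.im) ^ 2 * (2 + ‖h‖ ^ 2) +
        16 * m ^ 3 * (-c.im) * (-d.im) + 2 * m ^ 4 * ‖a‖ ^ 2) =
      12 * (m ^ 2 * ‖c‖ ^ 2) * 2 + 12 * (m ^ 2 * ‖c‖ ^ 2 * ‖h‖ ^ 2) +
        16 * (m ^ 3 * (c.re * d.re + c.im * d.im)) + 4 * m ^ 4 * ‖a‖ ^ 2 := by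
    rw [← hc]; ring
  rw [hkey]
  nlinarith

end Model

/-! ### Transport of functions to the manifold by the inverse of `Φ`. -/

section Transport

variable {n : ℕ} {M : Type*} [TopologicalSpace M] [ChartedSpace (Cn n) M]

/-- An injective holomorphic map from an open set of `ℂⁿ` to a complex manifold of dimension `n`
has, in every chart, a local inverse which is holomorphic with injective derivative. -/
theorem exists_holomorphic_local_inverse [IsManifold 𝓘(ℂ, Cn n) ω M] {Φ : Cn n → M}
    {D : Set (Cn n)} (hD : IsOpen D) (hΦ : ContMDiffOn 𝓘(ℂ, Cn n) 𝓘(ℂ, Cn n) ω Φ D)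
    (hinj : InjOn Φ D) {e : OpenPartialHomeomorph M (Cn n)}
    (he : e ∈ IsManifold.maximalAtlas 𝓘(ℂ, Cn n) ω M) {z : Cn n} (hz : z ∈ D)
    (hze : Φ z ∈ e.source) :
    ∃ F : Cn n → Cn n, ContDiffAt ℂ ω F (e (Φ z)) ∧ F (e (Φ z)) = z ∧
      Function.Injective (fderiv ℂ F (e (Φ z))) ∧
      ∀ᶠ y in 𝓝 (e (Φ z)), F y ∈ D ∧ Φ (F y) = e.symm y := by
  set Ω := D ∩ Φ ⁻¹' e.source
  have hΩ : IsOpen Ω := hΦ.continuousOn.isOpen_inter_preimage hD e.open_source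
  have hzΩ : z ∈ Ω := ⟨hz, hze⟩
  have hG : ContDiffOn ℂ ω (e ∘ Φ) Ω := contMDiffOn_iff_contDiffOn.1
    ((contMDiffOn_of_mem_maximalAtlas he).comp (hΦ.mono inter_subset_left)
      fun x hx ↦ hx.2)
  have hGa : AnalyticOnNhd ℂ (e ∘ Φ) Ω := fun x hx ↦
    (hG.contDiffAt (hΩ.mem_nhds hx)).analyticAt
  have hGinj : InjOn (e ∘ Φ) Ω := fun x hx y hy hxy ↦
    hinj hx.1 hy.1 (e.injOn hx.2 hy.2 hxy)
  -- Osgood's theorem enters here, allowing the inverse function theorem.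
  have hder := fderiv_injective_of_injOn rfl hΩ hGa hGinj hzΩ
  let A : Cn n ≃L[ℂ] Cn n := (LinearEquiv.ofInjectiveEndo
    (fderiv ℂ (e ∘ Φ) z).toLinearMap hder).toContinuousLinearEquiv
  have hA : (A : Cn n →L[ℂ] Cn n) = fderiv ℂ (e ∘ Φ) z := by ext x; rfl
  have hGd : HasFDerivAt (e ∘ Φ) (A : Cn n →L[ℂ] Cn n) z := by
    rw [hA]; exact (hGa z hzΩ).differentiableAt.hasFDerivAt
  have hcd := hG.contDiffAt (hΩ.mem_nhds hzΩ)
  let Θ := hcd.toOpenPartialHomeomorph (e ∘ Φ) hGd (by simp)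
  have hsrc : z ∈ Θ.source := hcd.mem_toOpenPartialHomeomorph_source hGd (by simp)
  have htgt : e (Φ z) ∈ Θ.target := hcd.image_mem_toOpenPartialHomeomorph_target hGd (by simp)
  have hFz : Θ.symm (e (Φ z)) = z := Θ.left_inv hsrc
  have hFd : HasFDerivAt Θ.symm (A.symm : Cn n →L[ℂ] Cn n) (e (Φ z)) :=
    Θ.hasFDerivAt_symm htgt (by rw [hFz]; exact hGd)
  refine ⟨Θ.symm, ?_, hFz, ?_, ?_⟩
  · refine Θ.contDiffAt_symm htgt (f₀' := A) ?_ ?_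
    · rw [hFz]; exact hGd
    · rw [hFz]; exact hcd
  · rw [hFd.fderiv]
    exact A.symm.injective
  · filter_upwards [Θ.open_target.mem_nhds htgt, hFd.continuousAt.eventually_mem
      (by rw [hFz]; exact hΩ.mem_nhds hzΩ)] with y hy hyΩ
    refine ⟨hyΩ.1, ?_⟩
    have : e (Φ (Θ.symm y)) = y := Θ.right_inv hy
    rw [← this, e.left_inv hyΩ.2]
    exact congrArg Φ (congrArg Θ.symm this)

variable [IsManifold 𝓘(ℂ, Cn n) ω M] {Φ : Cn n → M} {D V : Set (Cn n)}

/-- An injective holomorphic map into a manifold of the same dimension is open. -/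
theorem isOpen_image_of_injOn_holomorphic (hΦ : ContMDiffOn 𝓘(ℂ, Cn n) 𝓘(ℂ, Cn n) ω Φ D)
    (hinj : InjOn Φ D) (hV : IsOpen V) (hVD : V ⊆ D) : IsOpen (Φ '' V) := by
  rw [isOpen_iff_mem_nhds]
  rintro _ ⟨z, hz, rfl⟩
  have he := IsManifold.chart_mem_maximalAtlas (I := 𝓘(ℂ, Cn n)) (n := ω) (Φ z)
  obtain ⟨F, -, -, -, hF⟩ := exists_holomorphic_local_inverse hV (hΦ.mono hVD) (hinj.mono hVD) he
    hz (mem_chart_source _ _)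
  set e := chartAt (Cn n) (Φ z)
  have hsrc : Φ z ∈ e.source := mem_chart_source _ _
  filter_upwards [e.open_source.mem_nhds hsrc, (e.continuousAt hsrc).eventually hF] with p hp hpF
  exact ⟨F (e p), hpF.1, by rw [hpF.2, e.left_inv hp]⟩

/-- In a chart, the function `u ∘ Φ⁻¹` has the form `u ∘ F` with `F` biholomorphic. -/
theorem exists_comp_invFunOn_eventuallyEq (hΦ : ContMDiffOn 𝓘(ℂ, Cn n) 𝓘(ℂ, Cn n) ω Φ D)
    (hD : IsOpen D) (hinj : InjOn Φ D) (u : Cn n → ℝ) {e : OpenPartialHomeomorph M (Cn n)}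
    (he : e ∈ IsManifold.maximalAtlas 𝓘(ℂ, Cn n) ω M) {z : Cn n} (hz : z ∈ D)
    (hze : Φ z ∈ e.source) :
    ∃ F : Cn n → Cn n, ContDiffAt ℂ ω F (e (Φ z)) ∧ F (e (Φ z)) = z ∧
      Function.Injective (fderiv ℂ F (e (Φ z))) ∧
      (u ∘ Function.invFunOn Φ D) ∘ e.symm =ᶠ[𝓝 (e (Φ z))] u ∘ F := by
  obtain ⟨F, hF, hFz, hFi, hev⟩ := exists_holomorphic_local_inverse hD hΦ hinj he hz hze
  refine ⟨F, hF, hFz, hFi, hev.mono fun y hy ↦ ?_⟩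
  simp only [Function.comp_apply]
  rw [← hy.2, hinj.leftInvOn_invFunOn hy.1]

theorem contMDiffOn_comp_invFunOn (hΦ : ContMDiffOn 𝓘(ℂ, Cn n) 𝓘(ℂ, Cn n) ω Φ D)
    (hD : IsOpen D) (hinj : InjOn Φ D) {u : Cn n → ℝ} (hVD : V ⊆ D)
    (hu : ∀ z ∈ V, ContDiffAt ℝ 2 u z) :
    ContMDiffOn 𝓘(ℝ, Cn n) 𝓘(ℝ, ℝ) 2 (u ∘ Function.invFunOn Φ D) (Φ '' V) := by
  rintro _ ⟨z, hz, rfl⟩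
  refine ContMDiffAt.contMDiffWithinAt ?_
  have hsrc : Φ z ∈ (chartAt (Cn n) (Φ z)).source := mem_chart_source _ _
  obtain ⟨F, hF, hFz, -, hev⟩ := exists_comp_invFunOn_eventuallyEq hΦ hD hinj u
    (IsManifold.chart_mem_maximalAtlas (I := 𝓘(ℂ, Cn n)) (n := ω) (Φ z)) (hVD hz) hsrc
  have hc : ContDiffAt ℝ 2 ((u ∘ Function.invFunOn Φ D) ∘ (chartAt (Cn n) (Φ z)).symm)
      (chartAt (Cn n) (Φ z) (Φ z)) := by
    refine ContDiffAt.congr_of_eventuallyEq ?_ hev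
    refine ContDiffAt.comp _ (by rw [hFz]; exact hu z hz) ?_
    exact (hF.of_le le_top).restrict_scalars ℝ
  rw [contMDiffAt_iff]
  refine ⟨?_, ?_⟩
  · exact ((chartAt (Cn n) (Φ z)).symm.continuousAt_iff_continuousAt_comp_right
      (by simp)).2 (by simpa using hc.continuousAt)
  · simpa [extChartAt, chartAt_self_eq, Function.comp_assoc] using hc.contDiffWithinAt

variable {q : ℕ}

theorem isWeaklyQConvexOn_comp_invFunOn (hΦ : ContMDiffOn 𝓘(ℂ, Cn n) 𝓘(ℂ, Cn n) ω Φ D)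
    (hD : IsOpen D) (hinj : InjOn Φ D) {u : Cn n → ℝ} (hV : IsOpen V) (hVD : V ⊆ D)
    (hu : ∀ z ∈ V, ContDiffAt ℝ 2 u z) (hpos : ∀ z ∈ V, ∀ v, 0 ≤ leviForm u z v) (hq : 1 ≤ q) :
    IsWeaklyQConvexOn (n := n) q (u ∘ Function.invFunOn Φ D) (Φ '' V) where
  isOpen := isOpen_image_of_injOn_holomorphic hΦ hinj hV hVD
  contMDiffOn := contMDiffOn_comp_invFunOn hΦ hD hinj hVD hu
  levi := by
    rintro e he _ ⟨z, hz, rfl⟩ hze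
    obtain ⟨F, hF, hFz, -, hev⟩ := exists_comp_invFunOn_eventuallyEq hΦ hD hinj u he (hVD hz) hze
    have hu' : ContDiffAt ℝ 2 u (F (e (Φ z))) := by rw [hFz]; exact hu z hz
    have hF2 : ContDiffAt ℂ 2 F (e (Φ z)) := hF.of_le le_top
    rw [hev.leviMatrix_eq]
    refine ncard_leviMatrix_neg_lt (hu'.comp _ (hF2.restrict_scalars ℝ)) (fun v ↦ ?_) hq
    rw [leviForm_comp hu' hF2, hFz]
    exact hpos z hz _

/-- In a chart, the null vectors lie in the preimage of `K` under the injective derivative of `F`,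
whose dimension is at most that of `K`. -/
theorem isQConvexOn_comp_invFunOn (hΦ : ContMDiffOn 𝓘(ℂ, Cn n) 𝓘(ℂ, Cn n) ω Φ D)
    (hD : IsOpen D) (hinj : InjOn Φ D) {u : Cn n → ℝ} (hV : IsOpen V) (hVD : V ⊆ D)
    (hu : ∀ z ∈ V, ContDiffAt ℝ 2 u z) (hpos : ∀ z ∈ V, ∀ v, 0 ≤ leviForm u z v)
    {K : Submodule ℂ (Cn n)} (hK : Module.finrank ℂ K < q)
    (hzero : ∀ z ∈ V, ∀ v, leviForm u z v = 0 → v ∈ K) :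
    IsQConvexOn (n := n) q (u ∘ Function.invFunOn Φ D) (Φ '' V) where
  isOpen := isOpen_image_of_injOn_holomorphic hΦ hinj hV hVD
  contMDiffOn := contMDiffOn_comp_invFunOn hΦ hD hinj hVD hu
  levi := by
    rintro e he _ ⟨z, hz, rfl⟩ hze
    obtain ⟨F, hF, hFz, hFi, hev⟩ :=
      exists_comp_invFunOn_eventuallyEq hΦ hD hinj u he (hVD hz) hze
    have hu' : ContDiffAt ℝ 2 u (F (e (Φ z))) := by rw [hFz]; exact hu z hz
    have hF2 : ContDiffAt ℂ 2 F (e (Φ z)) := hF.of_le le_top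
    rw [hev.leviMatrix_eq]
    refine ncard_leviMatrix_nonpos_lt (K := K.comap (fderiv ℂ F (e (Φ z))).toLinearMap)
      (hu'.comp _ (hF2.restrict_scalars ℝ)) (fun v ↦ ?_) (lt_of_le_of_lt ?_ hK) (fun v hv ↦ ?_)
    · rw [leviForm_comp hu' hF2, hFz]
      exact hpos z hz _
    · let A : K.comap (fderiv ℂ F (e (Φ z))).toLinearMap →ₗ[ℂ] K :=
        (fderiv ℂ F (e (Φ z))).toLinearMap.restrict fun x hx ↦ hx
      refine LinearMap.finrank_le_finrank_of_injective (f := A) fun x y hxy ↦ ?_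
      exact Subtype.ext (hFi (congrArg Subtype.val hxy))
    · rw [leviForm_comp hu' hF2, hFz] at hv
      exact hzero z hz _ hv

end Transport

/-! ### The cut-off function on `ℂⁿ`. -/

section HatFunction

variable {k n : ℕ} [NeZero k]

/-- `hatModel` cut off outside the unit ball in the first `k` coordinates. -/
noncomputable def hatFunction (hk : k ≤ n) (r : ℝ) (z : Cn n) : ℝ :=
  open Classical in if ‖headCoords hk z‖ < 1 then hatModel hk r z else 0

theorem hatFunction_eventuallyEq_hatModel (hk : k ≤ n) (r : ℝ) {z : Cn n}
    (hz : ‖headCoords hk z‖ < 1) : hatFunction hk r =ᶠ[𝓝 z] hatModel hk r := by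
  filter_upwards [(continuous_headCoords hk).norm.continuousAt.eventually_lt_const hz] with y hy
  exact if_pos hy

theorem hatFunction_eq_zero (hk : k ≤ n) (r : ℝ) {z : Cn n}
    (hz : 1 < ‖headCoords hk z‖ ∨ (headCoords hk z 0).re < r) : hatFunction hk r z = 0 := by
  rw [hatFunction]
  split_ifs with h
  · have hr := hz.resolve_left (not_lt.2 h.le)
    rw [hatModel, max_eq_right (by linarith)]
    simp
  · rfl

theorem continuous_re_headCoords (hk : k ≤ n) :
    Continuous fun z : Cn n ↦ (headCoords hk z 0).re := by
  have := continuous_headCoords hk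
  fun_prop

theorem hatFunction_eventuallyEq_zero (hk : k ≤ n) (r : ℝ) {z : Cn n}
    (hz : 1 < ‖headCoords hk z‖ ∨ (headCoords hk z 0).re < r) :
    hatFunction hk r =ᶠ[𝓝 z] fun _ ↦ 0 := by
  have ho : IsOpen {z : Cn n | 1 < ‖headCoords hk z‖ ∨ (headCoords hk z 0).re < r} :=
    (isOpen_lt continuous_const (continuous_headCoords hk).norm).union
      (isOpen_lt (continuous_re_headCoords hk) continuous_const)
  exact (ho.eventually_mem hz).mono fun y hy ↦ hatFunction_eq_zero hk r hy

theorem norm_lt_or_of_notMem_sphericalHat {r : ℝ} {x : Cn k} (hx : x ∉ sphericalHat k r) :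
    ‖x‖ < 1 ∨ 1 < ‖x‖ ∨ (x 0).re < r := by
  rcases lt_trichotomy ‖x‖ 1 with h | h | h
  · exact Or.inl h
  · exact Or.inr (Or.inr (not_le.1 fun hr ↦ hx ⟨h, hr⟩))
  · exact Or.inr (Or.inl h)

/-- Off the hat, a point on the cut-off boundary `‖z'‖ = 1` has `Re z₁ < r`, so the function is zero
on both sides nearby. -/
theorem contDiffAt_hatFunction (hk : k ≤ n) (r : ℝ) {z : Cn n}
    (hz : headCoords hk z ∉ sphericalHat k r) : ContDiffAt ℝ 2 (hatFunction hk r) z := by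
  rcases norm_lt_or_of_notMem_sphericalHat hz with h | h
  · exact (contDiff_hatModel hk r).contDiffAt.congr_of_eventuallyEq
      (hatFunction_eventuallyEq_hatModel hk r h)
  · exact contDiffAt_const.congr_of_eventuallyEq (hatFunction_eventuallyEq_zero hk r h)

theorem leviForm_hatFunction_nonneg (hk : k ≤ n) (r : ℝ) {z : Cn n}
    (hz : headCoords hk z ∉ sphericalHat k r) (v : Cn n) : 0 ≤ leviForm (hatFunction hk r) z v := by
  rcases norm_lt_or_of_notMem_sphericalHat hz with h | h
  · rw [(hatFunction_eventuallyEq_hatModel hk r h).leviForm_eq]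
    exact le_trans (by positivity) (leviForm_hatModel_ge hk r h.le v)
  · rw [(hatFunction_eventuallyEq_zero hk r h).leviForm_eq]
    simp [leviForm, realHessian]

theorem headCoords_eq_zero_of_leviForm_hatFunction (hk : k ≤ n) (r : ℝ) {z : Cn n}
    (hz : ‖headCoords hk z‖ < 1) (hr : r < (headCoords hk z 0).re) {v : Cn n}
    (hv : leviForm (hatFunction hk r) z v = 0) : headCoords hk v = 0 := by
  rw [(hatFunction_eventuallyEq_hatModel hk r hz).leviForm_eq] at hv
  have h := leviForm_hatModel_ge hk r hz.le v
  rw [hv, max_eq_left (by linarith)] at h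
  have hpos : 0 < ((headCoords hk z 0).re - r) ^ 4 := pow_pos (by linarith) 4
  have h0 : ‖headCoords hk v‖ ^ 2 ≤ 0 := nonpos_of_mul_nonpos_right h hpos
  exact norm_eq_zero.1 (pow_eq_zero_iff (two_ne_zero) |>.1 (le_antisymm h0 (sq_nonneg _)))

theorem hatFunction_pos (hk : k ≤ n) (r : ℝ) {z : Cn n}
    (hz : ‖headCoords hk z‖ < 1) (hr : r < (headCoords hk z 0).re) : 0 < hatFunction hk r z := by
  rw [hatFunction, if_pos hz, hatModel, max_eq_left (by linarith)]
  have hpos : 0 < ((headCoords hk z 0).re - r) ^ 4 := pow_pos (by linarith) 4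
  positivity

theorem norm_lt_and_lt_re_of_mem_interior (hk : k ≤ n) {r : ℝ} {B : Set (Cn (n - k))} {z : Cn n}
    (hz : z ∈ interior (coordProd hk (filledSphericalHat k r) B)) :
    ‖headCoords hk z‖ < 1 ∧ r < (headCoords hk z 0).re := by
  have hmem := interior_subset hz
  -- An interior point can be moved slightly in any direction: outwards along `z` to exclude norm
  -- one, and along `-e₁` to exclude `Re z₁ = r`.
  have hev : ∀ v : Cn n, ∃ s : ℝ, 0 < s ∧
      z + s • v ∈ coordProd hk (filledSphericalHat k r) B := by
    intro v
    have hc : ContinuousAt (fun s : ℝ ↦ z + s • v) 0 := by fun_prop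
    have h := hc.eventually_mem (by simpa using mem_interior_iff_mem_nhds.1 hz)
    obtain ⟨s, hs, hpos⟩ := ((h.filter_mono nhdsWithin_le_nhds).and
      (self_mem_nhdsWithin (s := Ioi (0 : ℝ)) (a := 0))).exists
    exact ⟨s, hpos, hs⟩
  constructor
  · refine lt_of_le_of_ne hmem.1.1 fun h1 ↦ ?_
    obtain ⟨s, hs, hsm⟩ := hev z
    have h2 : headCoords hk (z + s • z) = (1 + s) • headCoords hk z := by
      rw [add_smul, one_smul]; rfl
    have h3 := hsm.1.1
    rw [h2, norm_smul, h1, Real.norm_eq_abs, abs_of_pos (by linarith)] at h3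
    linarith
  · refine lt_of_le_of_ne hmem.1.2 fun h1 ↦ ?_
    obtain ⟨s, hs, hsm⟩ := hev (-EuclideanSpace.single (Fin.castLE hk 0) 1)
    have h2 : (headCoords hk (z + s • -EuclideanSpace.single (Fin.castLE hk 0) 1) 0).re =
        (headCoords hk z 0).re - s := by
      simp [headCoords, sub_eq_add_neg]
    have h3 := hsm.1.2
    rw [h2] at h3
    linarith

end HatFunction

/-! ### Assembly of the theorem. -/

theorem isOpen_unitPolydisc (m : ℕ) : IsOpen (unitPolydisc m) := by
  simp only [unitPolydisc, ofPred_forall]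
  exact isOpen_iInter_of_finite fun i ↦ isOpen_lt (by fun_prop) continuous_const

theorem isClosed_sphericalHat (k : ℕ) [NeZero k] (r : ℝ) : IsClosed (sphericalHat k r) :=
  (isClosed_eq (f := fun z : Cn k ↦ ‖z‖) continuous_norm continuous_const).inter
    (isClosed_le (g := fun z : Cn k ↦ (z 0).re) continuous_const (by fun_prop))

theorem continuous_tailCoords {k n : ℕ} (hk : k ≤ n) : Continuous (tailCoords (k := k) hk) :=
  (PiLp.continuous_toLp 2 fun _ : Fin (n - k) ↦ ℂ).comp
    (continuous_pi fun i ↦ by fun_prop)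

theorem mainTheorem7 {n q : ℕ} (hq : 1 ≤ q) (hqn : q ≤ n)
    {M : Type*} [TopologicalSpace M] [T2Space M] [ChartedSpace (Cn n) M]
    [IsManifold 𝓘(ℂ, Cn n) ω M] (P : SphericalHatPair (n - q + 1) n M) :
    ∃ U : Set M, IsOpen U ∧ P.filledHat ⊆ U ∧
      ∃ φ : M → ℝ,
        IsWeaklyQConvexOn (n := n) q φ (U \ P.hat) ∧
        (∀ x ∈ U \ P.filledHat, φ x = 0) ∧
        (∀ x ∈ P.filling, 0 < φ x) ∧
        IsQConvexOn (n := n) q φ P.filling := by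
  set hk := P.order_le
  -- The last coordinates are kept in the open polydisc, since `dom` may reach beyond it. Thus `S`
  -- is relatively closed in `U`, and a point of `U` outside the filled hat has its first
  -- coordinates outside the filled spherical hat.
  let V : Set (Cn n) := P.dom ∩ tailCoords hk ⁻¹' unitPolydisc (n - (n - q + 1))
  have hV : IsOpen V :=
    P.isOpen_dom.inter ((isOpen_unitPolydisc _).preimage (continuous_tailCoords hk))
  have hVD : V ⊆ P.dom := inter_subset_left
  have hfilled : coordProd hk (filledSphericalHat (n - q + 1) P.r)
      (unitPolydisc (n - (n - q + 1))) ⊆ V := fun z hz ↦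
    ⟨P.subset_dom ⟨hz.1, subset_closure hz.2⟩, hz.2⟩
  have hhat : coordProd hk (sphericalHat (n - q + 1) P.r)
      (unitPolydisc (n - (n - q + 1))) ⊆ V := fun z hz ↦
    hfilled ⟨⟨hz.1.1.le, hz.1.2⟩, hz.2⟩
  have hdiff : P.toFun '' V \ P.hat =
      P.toFun '' (V \ headCoords hk ⁻¹' sphericalHat (n - q + 1) P.r) := by
    have h1 : V \ headCoords hk ⁻¹' sphericalHat (n - q + 1) P.r =
        V \ coordProd hk (sphericalHat (n - q + 1) P.r) (unitPolydisc (n - (n - q + 1))) := by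
      ext z
      exact ⟨fun h ↦ ⟨h.1, fun hz ↦ h.2 hz.1⟩, fun h ↦ ⟨h.1, fun hz ↦ h.2 ⟨hz, h.1.2⟩⟩⟩
    rw [h1, (P.injOn.mono hVD).image_sdiff_subset hhat]
    rfl
  have hΨ : ∀ z ∈ P.dom, Function.invFunOn P.toFun P.dom (P.toFun z) = z := fun z hz ↦
    P.injOn.leftInvOn_invFunOn hz
  have hint : ∀ z ∈ interior (coordProd hk (filledSphericalHat (n - q + 1) P.r)
      (unitPolydisc (n - (n - q + 1)))), z ∈ P.dom ∧ ‖headCoords hk z‖ < 1 ∧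
      P.r < (headCoords hk z 0).re := fun z hz ↦
    ⟨hVD (hfilled (interior_subset hz)), norm_lt_and_lt_re_of_mem_interior hk hz⟩
  refine ⟨P.toFun '' V, isOpen_image_of_injOn_holomorphic P.holomorphic P.injOn hV hVD,
    image_mono hfilled, hatFunction hk P.r ∘ Function.invFunOn P.toFun P.dom, ?_, ?_, ?_, ?_⟩
  · rw [hdiff]
    exact isWeaklyQConvexOn_comp_invFunOn P.holomorphic P.isOpen_dom P.injOn
      (hV.sdiff ((isClosed_sphericalHat _ _).preimage (continuous_headCoords hk)))
      (sdiff_subset.trans hVD) (fun z hz ↦ contDiffAt_hatFunction hk P.r hz.2)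
      (fun z hz ↦ leviForm_hatFunction_nonneg hk P.r hz.2) hq
  · rintro _ ⟨⟨z, hz, rfl⟩, hnz⟩
    rw [Function.comp_apply, hΨ z (hVD hz)]
    refine hatFunction_eq_zero hk P.r ?_
    by_contra! hcon
    exact hnz ⟨z, ⟨hcon, hz.2⟩, rfl⟩
  · rintro _ ⟨z, hz, rfl⟩
    rw [Function.comp_apply, hΨ z (hint z hz).1]
    exact hatFunction_pos hk P.r (hint z hz).2.1 (hint z hz).2.2
  · have hns : ∀ z ∈ interior (coordProd hk (filledSphericalHat (n - q + 1) P.r)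
        (unitPolydisc (n - (n - q + 1)))), headCoords hk z ∉ sphericalHat (n - q + 1) P.r :=
      fun z hz h ↦ (hint z hz).2.1.ne h.1
    refine isQConvexOn_comp_invFunOn P.holomorphic P.isOpen_dom P.injOn isOpen_interior
      (fun z hz ↦ (hint z hz).1) (fun z hz ↦ contDiffAt_hatFunction hk P.r (hns z hz))
      (fun z hz ↦ leviForm_hatFunction_nonneg hk P.r (hns z hz))
      (K := (headCoordsL hk).ker) ?_ (fun z hz v hv ↦
        headCoords_eq_zero_of_leviForm_hatFunction hk P.r (hint z hz).2.1 (hint z hz).2.2 hv)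
    -- Rank-nullity gives a kernel of dimension `n - (n - q + 1) = q - 1`.
    have h1 := (headCoordsL hk).toLinearMap.finrank_range_add_finrank_ker
    rw [LinearMap.range_eq_top.2 (headCoordsL_surjective hk), finrank_top,
      finrank_euclideanSpace_fin, finrank_euclideanSpace_fin] at h1
    omega
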